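/- Let $\mathbb S^1=[0,1]/(0\sim1)$. Thompson's group $T$ is the group of piecewise linear homeomorphisms of $\mathbb S^1$ that preserve the set of dyadic points, have finitely many breakpoints, all of them dyadic, and have slopes in $\{2^k:k\in\mathbb Z\}$. Let $V\colon\mathbb C^d\to\mathbb C^d\otimes\mathbb C^d$ be an isometry with $\mathrm{swap}\circ V=V$. For a standard dyadic partition $P$ of $\mathbb S^1$ let $\mathfrak H_P=(\mathbb C^d)^{\otimes|P|}$, one tensor factor for each interval of $P$. If $Q$ refines $P$, let $\mathfrak H_P\to\mathfrak H_Q$ be the isometry that applies $V$ at every halving of an interval. The semicontinuous limit $\mathfrak H$ is the Hilbert space direct limit of the $\mathfrak H_P$. For $f\in T$ the unitary $U(f)$ on $\mathfrak H$ is given as follows: if $f$ maps every interval of $P$ affinely onto an interval of a standard dyadic partition $f(P)$, then $U(f)$ maps the class of $\psi\in\mathfrak H_P$ to the class of the vector of $\mathfrak H_{f(P)}$ obtained by moving the tensor factor at $I$ to $f(I)$. This is a unitary representation of $T$. The vacuum $\Omega\in\mathfrak H$ is the class of the unit vector $d^{-1/2}\sum_i (Ve_i)\otimes e_i\in\mathfrak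 H_{\{[0,\frac14],[\frac14,\frac12],[\frac12,1]\}}$. Let $E(A)=V^\dagger(A\otimes\mathbf 1)V$ on $M_d(\mathbb C)$, and let $(\mu^\alpha)$ be eigenvectors, $E(\mu^\alpha)=\lambda_\alpha\mu^\alpha$ (for example an eigenbasis if $E$ is diagonalizable). Put $h_\alpha=-\operatorname{Re}\log_2\lambda_\alpha$ and $$\phi^\alpha_P(z)=\sum_{I\in P}\chi_I(z)\,\lambda_\alpha^{\log_2|I|}\,\mu^\alpha_I ,$$ where the intervals $I$ are half open and $\mu^\alpha_I$ acts on the tensor factor at $I$. If $\psi\in\mathfrak H$ has a representative $\psi_P\in\mathfrak H_P$ for some $P$ (hence also on all refinements of that $P$), its $n$-point function is the limit along the directed set of standard dyadic partitions $$C^{\boldsymbol\alpha}_\psi(z_1,\dots,z_n)=\lim_P\,\langle\psi_P,\phi_P^{\alpha_1}(z_1)\cdots\phi_P^{\alpha_n}(z_n)\psi_P\rangle .$$ **Theorem.** Let $f\in T$, let $x_1,\dots,x_n\in[0,1)$ be pairwise distinct, and let $\alpha_1,\dots,\alpha_n$ be indices with $\lambda_{\alpha_j}\neq0$. Then the right derivative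 $f'(x_j)=\frac{df}{dx}\big|_{x=x_j^+}$ exists and is an integer power of $2$ for every $j$, the limits $C^{\boldsymbol\alpha}_\Omega(x_1,\dots,x_n)$ and $C^{\boldsymbol\alpha}_{U(f)\Omega}(f(x_1),\dots,f(x_n))$ exist, and $$C^{\boldsymbol\alpha}_\Omega(x_1,\dots,x_n)=\prod_{j=1}^n\lambda_{\alpha_j}^{-\log_2 f'(x_j)}\;C^{\boldsymbol\alpha}_{U(f)\Omega}(f(x_1),\dots,f(x_n)).$$ In particular $$\bigl|C^{\boldsymbol\alpha}_\Omega(x_1,\dots,x_n)\bigr|=\prod_{j=1}^n f'(x_j)^{h_{\alpha_j}}\;\bigl|C^{\boldsymbol\alpha}_{U(f)\Omega}(f(x_1),\dots,f(x_n))\bigr| ,$$ and if all $\lambda_{\alpha_j}$ are positive real numbers, this holds without the absolute values: $$C^{\boldsymbol\alpha}_\Omega(x_1,\dots,x_n)=\prod_{j=1}^n f'(x_j)^{h_{\alpha_j}}\;C^{\boldsymbol\alpha}_{U(f)\Omega}(f(x_1),\dots,f(x_n)).$$ -/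

import Mathlib

open Filter Topology
open scoped Kronecker Matrix ComplexConjugate

namespace ThompsonField

/-- Standard dyadic partitions of the circle `[0,1]/(0 ~ 1)`: either the undivided interval, or the
interval cut in two equal halves, each of which carries a (rescaled) standard dyadic partition. -/
inductive DyadicPartition : Type
  | whole : DyadicPartition
  | split : DyadicPartition → DyadicPartition → DyadicPartition

open DyadicPartition

/-- The index set of the intervals of a partition, from left to right. -/
def Piece : DyadicPartition → Type
  | whole => Unit
  | split l r => Piece l ⊕ Piece r

instance instFintypePiece : (P : DyadicPartition) → Fintype (Piece P)
  | whole => inferInstanceAs (Fintype Unit)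
  | split l r => @instFintypeSum _ _ (instFintypePiece l) (instFintypePiece r)

instance instDecidableEqPiece : (P : DyadicPartition) → DecidableEq (Piece P)
  | whole => inferInstanceAs (DecidableEq Unit)
  | split l r => @instDecidableEqSum _ _ (instDecidableEqPiece l) (instDecidableEqPiece r)

/-- The left end point of an interval of a partition. -/
noncomputable def left : (P : DyadicPartition) → Piece P → ℝ
  | whole, _ => 0
  | split l _, Sum.inl p => left l p / 2
  | split _ r, Sum.inr p => (1 + left r p) / 2

/-- The interval `p` of the partition `P` has length `2 ^ (-level P p)`. -/
def level : (P : DyadicPartition) → Piece P → ℕ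
  | whole, _ => 0
  | split l _, Sum.inl p => level l p + 1
  | split _ r, Sum.inr p => level r p + 1

/-- The length of an interval of a partition. -/
noncomputable def len (P : DyadicPartition) (p : Piece P) : ℝ := (2 : ℝ)⁻¹ ^ level P p

/-- `Coarser P Q`: the partition `Q` refines the partition `P`. -/
def Coarser : DyadicPartition → DyadicPartition → Prop
  | whole, _ => True
  | split _ _, whole => False
  | split l r, split l' r' => Coarser l l' ∧ Coarser r r'

theorem coarser_refl : ∀ P, Coarser P P
  | whole => trivial
  | split l r => ⟨coarser_refl l, coarser_refl r⟩

theorem coarser_trans : ∀ {P Q R}, Coarser P Q → Coarser Q R → Coarser P R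
  | whole, _, _, _, _ => trivial
  | split _ _, split _ _, split _ _, h, h' => ⟨coarser_trans h.1 h'.1, coarser_trans h.2 h'.2⟩

/-- Partitions ordered by refinement: `P ≤ Q` if `Q` refines `P`. -/
instance instPreorderDyadicPartition : Preorder DyadicPartition where
  le := Coarser
  le_refl := coarser_refl
  le_trans _ _ _ := coarser_trans

theorem split_le_split {l r l' r' : DyadicPartition} :
    split l r ≤ split l' r' ↔ l ≤ l' ∧ r ≤ r' := Iff.rfl

theorem whole_le (P : DyadicPartition) : whole ≤ P := trivial

theorem exists_common_refinement : ∀ P Q : DyadicPartition, ∃ R, P ≤ R ∧ Q ≤ R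
  | whole, Q => ⟨Q, trivial, le_refl Q⟩
  | split l r, whole => ⟨split l r, le_refl _, trivial⟩
  | split l r, split l' r' =>
    let ⟨a, h1, h2⟩ := exists_common_refinement l l'
    let ⟨b, h3, h4⟩ := exists_common_refinement r r'
    ⟨split a b, ⟨h1, h3⟩, ⟨h2, h4⟩⟩

instance instDirectedDyadicPartition : IsDirectedOrder DyadicPartition :=
  ⟨exists_common_refinement⟩

instance instNonemptyDyadicPartition : Nonempty DyadicPartition := ⟨whole⟩

/-- The Hilbert space `(ℂ^d)^{⊗|P|}`, with one tensor factor for each interval of `P`, in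
coordinates with respect to the standard product basis. -/
abbrev State (d : ℕ) (P : DyadicPartition) : Type := EuclideanSpace ℂ (Piece P → Fin d)

/-- A three-legged tensor, given as an isometry `V : ℂ^d → ℂ^d ⊗ ℂ^d` in coordinates. -/
abbrev Vertex (d : ℕ) : Type :=
  EuclideanSpace ℂ (Fin d) →ₗᵢ[ℂ] EuclideanSpace ℂ (Fin d × Fin d)

/-- The matrix of `V` with respect to the standard bases: the entry at `(a, b), i` is
`⟨e_a ⊗ e_b, V e_i⟩`. -/
noncomputable def vertexMatrix {d : ℕ} (V : Vertex d) : Matrix (Fin d × Fin d) (Fin d) ℂ :=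
  Matrix.of fun ab i => V (EuclideanSpace.single i 1) ab

/-- The matrix entries of the tree tensor `ℂ^d → (ℂ^d)^{⊗|P|}` obtained by putting a copy of `V` at
every branching of the binary tree of `P`. -/
noncomputable def treeAmp {d : ℕ} (V : Vertex d) :
    (P : DyadicPartition) → Fin d → (Piece P → Fin d) → ℂ
  | whole, i, k => if k () = i then 1 else 0
  | split l r, i, k => ∑ ab : Fin d × Fin d, vertexMatrix V ab i *
      (treeAmp V l ab.1 (fun p => k (Sum.inl p)) * treeAmp V r ab.2 (fun p => k (Sum.inr p)))

/-- The matrix entries of the fine-graining map from `P` to a refinement `Q`: the tensor product,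
over the intervals of `P`, of the tree tensors that subdivide them (zero if `Q` does not
refine `P`). -/
noncomputable def refineAmp {d : ℕ} (V : Vertex d) :
    (P Q : DyadicPartition) → (Piece P → Fin d) → (Piece Q → Fin d) → ℂ
  | whole, Q, i, k => treeAmp V Q (i ()) k
  | split _ _, whole, _, _ => 0
  | split l r, split l' r', i, k =>
      refineAmp V l l' (fun p => i (Sum.inl p)) (fun p => k (Sum.inl p)) *
      refineAmp V r r' (fun p => i (Sum.inr p)) (fun p => k (Sum.inr p))

theorem vertexMatrix_isometry {d : ℕ} (V : Vertex d) (i j : Fin d) :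
    ∑ ab, conj (vertexMatrix V ab i) * vertexMatrix V ab j = if i = j then 1 else 0 := by
  have h := V.inner_map_map (EuclideanSpace.single i (1 : ℂ)) (EuclideanSpace.single j (1 : ℂ))
  rw [EuclideanSpace.inner_single_left, PiLp.inner_apply] at h
  simp only [RCLike.inner_apply, map_one, one_mul, PiLp.single_apply] at h
  simp only [vertexMatrix, Matrix.of_apply]
  rw [← h]
  exact Finset.sum_congr rfl fun _ _ => mul_comm _ _

theorem sum_piece_split {d : ℕ} {l r : DyadicPartition} (F : (Piece (split l r) → Fin d) → ℂ) :
    ∑ k, F k = ∑ a : Piece l → Fin d, ∑ b : Piece r → Fin d, F (Sum.elim a b) := by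
  rw [← Fintype.sum_prod_type' (fun a b => F (Sum.elim a b))]
  exact Fintype.sum_equiv (Equiv.sumArrowEquivProdArrow (Piece l) (Piece r) (Fin d)) F
    (fun x => F (Sum.elim x.1 x.2)) (fun k => by
      congr 1; ext p; rcases p with p | p <;> rfl)

theorem sum_piece_whole {d : ℕ} (F : (Piece whole → Fin d) → ℂ) :
    ∑ k, F k = ∑ a : Fin d, F (fun _ => a) :=
  Fintype.sum_equiv (Equiv.funUnique Unit (Fin d)) _ _ (fun _ => rfl)

theorem treeAmp_isometry {d : ℕ} (V : Vertex d) : ∀ (P : DyadicPartition) (i j : Fin d),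
    ∑ k, conj (treeAmp V P i k) * treeAmp V P j k = if i = j then 1 else 0
  | whole, i, j => by
    rw [sum_piece_whole]
    simp [treeAmp, eq_comm]
  | split l r, i, j => by
    rw [sum_piece_split, ← vertexMatrix_isometry V i j]
    simp only [treeAmp, Sum.elim_inl, Sum.elim_inr, map_sum, map_mul, Finset.sum_mul_sum]
    have key : ∀ (ab cd : Fin d × Fin d),
        ∑ a : Piece l → Fin d, ∑ b : Piece r → Fin d,
          conj (vertexMatrix V ab i) * (conj (treeAmp V l ab.1 a) * conj (treeAmp V r ab.2 b)) *
          (vertexMatrix V cd j * (treeAmp V l cd.1 a * treeAmp V r cd.2 b))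
        = conj (vertexMatrix V ab i) * vertexMatrix V cd j * (if ab = cd then 1 else 0) := by
      intro ab cd
      have h1 := treeAmp_isometry V l ab.1 cd.1
      have h2 := treeAmp_isometry V r ab.2 cd.2
      have : (if ab = cd then (1 : ℂ) else 0) =
          (if ab.1 = cd.1 then 1 else 0) * (if ab.2 = cd.2 then 1 else 0) := by
        simp only [Prod.ext_iff]; split_ifs <;> simp_all
      rw [this, ← h1, ← h2, Finset.sum_mul_sum, Finset.mul_sum]
      refine Finset.sum_congr rfl fun a _ => ?_
      rw [Finset.mul_sum]
      refine Finset.sum_congr rfl fun b _ => by ring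
    calc _ = ∑ ab : Fin d × Fin d, ∑ cd : Fin d × Fin d,
          ∑ a : Piece l → Fin d, ∑ b : Piece r → Fin d,
          conj (vertexMatrix V ab i) * (conj (treeAmp V l ab.1 a) * conj (treeAmp V r ab.2 b)) *
          (vertexMatrix V cd j * (treeAmp V l cd.1 a * treeAmp V r cd.2 b)) := by
          rw [Finset.sum_congr rfl fun a _ => Finset.sum_comm]
          rw [Finset.sum_comm]
          refine Finset.sum_congr rfl fun ab _ => ?_
          rw [Finset.sum_congr rfl fun a _ => Finset.sum_comm]
          rw [Finset.sum_comm]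
      _ = _ := by
          simp only [key, mul_ite, mul_one, mul_zero, Finset.sum_ite_eq, Finset.mem_univ, if_true]

theorem refineAmp_isometry {d : ℕ} (V : Vertex d) : ∀ {P Q : DyadicPartition}, P ≤ Q →
    ∀ (i j : Piece P → Fin d),
    ∑ k, conj (refineAmp V P Q i k) * refineAmp V P Q j k = if i = j then 1 else 0
  | whole, Q, _, i, j => by
    simp only [refineAmp, treeAmp_isometry]
    have : (i = j) ↔ (i () = j ()) := ⟨fun h => by rw [h], fun h => funext fun _ => h⟩
    simp only [this]
  | split l r, split l' r', h, i, j => by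
    rw [sum_piece_split]
    simp only [refineAmp, Sum.elim_inl, Sum.elim_inr, map_mul]
    have h1 := refineAmp_isometry V h.1 (fun p => i (Sum.inl p)) (fun p => j (Sum.inl p))
    have h2 := refineAmp_isometry V h.2 (fun p => i (Sum.inr p)) (fun p => j (Sum.inr p))
    have : (if i = j then (1 : ℂ) else 0) =
          (if (fun p => i (Sum.inl p)) = (fun p => j (Sum.inl p)) then 1 else 0) *
          (if (fun p => i (Sum.inr p)) = (fun p => j (Sum.inr p)) then 1 else 0) := by
      have : i = j ↔ ((fun p => i (Sum.inl p)) = (fun p => j (Sum.inl p))) ∧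
          ((fun p => i (Sum.inr p)) = (fun p => j (Sum.inr p))) :=
        ⟨fun h => by rw [h]; exact ⟨rfl, rfl⟩, fun h => funext fun p => by
          rcases p with p | p
          exacts [congrFun h.1 p, congrFun h.2 p]⟩
      simp only [this]; split_ifs <;> simp_all
    rw [this, ← h1, ← h2, Finset.sum_mul_sum]
    exact Finset.sum_congr rfl fun a _ => Finset.sum_congr rfl fun b _ => by ring

theorem refineAmp_self {d : ℕ} (V : Vertex d) : ∀ (P : DyadicPartition) (i k : Piece P → Fin d),
    refineAmp V P P i k = if k = i then 1 else 0
  | whole, i, k => by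
    have : (k = i) ↔ (k () = i ()) := ⟨fun h => by rw [h], fun h => funext fun _ => h⟩
    simp only [refineAmp, treeAmp, this]
  | split l r, i, k => by
    have : k = i ↔ ((fun p => k (Sum.inl p)) = (fun p => i (Sum.inl p))) ∧
          ((fun p => k (Sum.inr p)) = (fun p => i (Sum.inr p))) :=
        ⟨fun h => by rw [h]; exact ⟨rfl, rfl⟩, fun h => funext fun p => by
          rcases p with p | p
          exacts [congrFun h.1 p, congrFun h.2 p]⟩
    simp only [refineAmp, refineAmp_self V l, refineAmp_self V r, this]
    split_ifs <;> simp_all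

theorem treeAmp_refine {d : ℕ} (V : Vertex d) : ∀ {Q R : DyadicPartition}, Q ≤ R →
    ∀ (i : Fin d) (k : Piece R → Fin d),
    ∑ j, treeAmp V Q i j * refineAmp V Q R j k = treeAmp V R i k
  | whole, R, _, i, k => by
    rw [sum_piece_whole]
    simp [treeAmp, refineAmp]
  | split l r, split l' r', h, i, k => by
    rw [sum_piece_split]
    simp only [treeAmp, refineAmp, Sum.elim_inl, Sum.elim_inr]
    simp only [← treeAmp_refine V h.1, ← treeAmp_refine V h.2]
    simp only [Finset.sum_mul]
    rw [Finset.sum_congr rfl fun a _ => Finset.sum_comm]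
    rw [Finset.sum_comm]
    refine Finset.sum_congr rfl fun ab _ => ?_
    rw [Finset.mul_sum]
    refine Finset.sum_congr rfl fun a _ => ?_
    rw [Finset.mul_sum, Finset.mul_sum]
    exact Finset.sum_congr rfl fun b _ => by ring

theorem refineAmp_trans {d : ℕ} (V : Vertex d) : ∀ {P Q R : DyadicPartition}, P ≤ Q → Q ≤ R →
    ∀ (i : Piece P → Fin d) (k : Piece R → Fin d),
    ∑ j, refineAmp V P Q i j * refineAmp V Q R j k = refineAmp V P R i k
  | whole, _, _, _, h, i, k => treeAmp_refine V h (i ()) k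
  | split l r, split l' r', split l'' r'', h, h', i, k => by
    rw [sum_piece_split]
    simp only [refineAmp, Sum.elim_inl, Sum.elim_inr]
    rw [← refineAmp_trans V h.1 h'.1, ← refineAmp_trans V h.2 h'.2, Finset.sum_mul_sum]
    exact Finset.sum_congr rfl fun a _ => Finset.sum_congr rfl fun b _ => by ring

/-- The fine-graining isometry from the states on `P` to the states on a refinement `Q`. -/
noncomputable def fineGrain {d : ℕ} (V : Vertex d) (P Q : DyadicPartition) (h : P ≤ Q) :
    State d P →ₗᵢ[ℂ] State d Q :=
  LinearMap.isometryOfInner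
    { toFun := fun ψ => WithLp.toLp 2 fun k => ∑ i, refineAmp V P Q i k * ψ i
      map_add' := fun ψ φ => by
        ext k; simp [mul_add, Finset.sum_add_distrib]
      map_smul' := fun c ψ => by
        ext k; simp [Finset.mul_sum, mul_left_comm] }
    (fun ψ φ => by
      simp only [PiLp.inner_apply, RCLike.inner_apply, LinearMap.coe_mk, AddHom.coe_mk, map_sum,
        map_mul, Finset.sum_mul_sum]
      have key : ∀ i j : Piece P → Fin d,
          ∑ k, refineAmp V P Q i k * φ i * (conj (refineAmp V P Q j k) * conj (ψ j))
            = (if j = i then 1 else 0) * (φ i * conj (ψ j)) := by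
        intro i j
        rw [← refineAmp_isometry V h, Finset.sum_mul]
        exact Finset.sum_congr rfl fun k _ => by ring
      rw [Finset.sum_comm]
      refine Finset.sum_congr rfl fun i _ => ?_
      rw [Finset.sum_comm]
      simp only [key]
      simp)

theorem fineGrain_apply {d : ℕ} (V : Vertex d) {P Q : DyadicPartition} (h : P ≤ Q)
    (ψ : State d P) (k : Piece Q → Fin d) :
    fineGrain V P Q h ψ k = ∑ i, refineAmp V P Q i k * ψ i := rfl

instance instDirectedSystem {d : ℕ} (V : Vertex d) :
    DirectedSystem (State d) (fun P Q h => (fineGrain V P Q h : State d P → State d Q)) where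
  map_self P ψ := by
    ext k
    rw [fineGrain_apply]
    simp [refineAmp_self]
  map_map P Q R h h' ψ := by
    ext k
    simp only [fineGrain_apply, ← refineAmp_trans V h h', Finset.mul_sum, Finset.sum_mul]
    rw [Finset.sum_comm]
    exact Finset.sum_congr rfl fun i _ => Finset.sum_congr rfl fun j _ => by ring

/-- The algebraic direct limit of the state spaces along the fine-graining isometries. -/
def PreLimit {d : ℕ} (V : Vertex d) : Type := DirectLimit (State d) (fineGrain V)

noncomputable instance instAddCommGroupPreLimit {d : ℕ} (V : Vertex d) :
    AddCommGroup (PreLimit V) := inferInstanceAs (AddCommGroup (DirectLimit _ (fineGrain V)))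

noncomputable instance instModulePreLimit {d : ℕ} (V : Vertex d) :
    Module ℂ (PreLimit V) := inferInstanceAs (Module ℂ (DirectLimit _ (fineGrain V)))

/-- The class in the direct limit of a state on the partition `P`. -/
noncomputable def preIncl {d : ℕ} (V : Vertex d) (P : DyadicPartition) :
    State d P →ₗ[ℂ] PreLimit V :=
  DirectLimit.Module.of ℂ DyadicPartition (State d) (fineGrain V) P

/-- The inner product of two classes, computed on a common refinement. -/
noncomputable def preInner {d : ℕ} (V : Vertex d) : PreLimit V → PreLimit V → ℂ :=
  DirectLimit.lift₂ (fineGrain V) (fineGrain V) (fun _ ψ φ => inner ℂ ψ φ)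
    (fun P Q h ψ φ => ((fineGrain V P Q h).inner_map_map ψ φ).symm)

theorem preInner_incl {d : ℕ} (V : Vertex d) (P : DyadicPartition) (ψ φ : State d P) :
    preInner V (preIncl V P ψ) (preIncl V P φ) = inner ℂ ψ φ :=
  DirectLimit.lift₂_def (fineGrain V) (fineGrain V) _ _ P ψ φ

theorem preIncl_fineGrain {d : ℕ} (V : Vertex d) {P Q : DyadicPartition} (h : P ≤ Q)
    (ψ : State d P) : preIncl V Q (fineGrain V P Q h ψ) = preIncl V P ψ :=
  DirectLimit.mk_apply P Q ψ h

theorem exists_preIncl {d : ℕ} (V : Vertex d) (z : PreLimit V) : ∃ P ψ, z = preIncl V P ψ :=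
  DirectLimit.exists_eq_mk (fineGrain V) z

theorem exists_preIncl₂ {d : ℕ} (V : Vertex d) (z w : PreLimit V) :
    ∃ P ψ φ, z = preIncl V P ψ ∧ w = preIncl V P φ :=
  DirectLimit.exists_eq_mk₂ (fineGrain V) z w

theorem exists_preIncl₃ {d : ℕ} (V : Vertex d) (z w u : PreLimit V) :
    ∃ P ψ φ χ, z = preIncl V P ψ ∧ w = preIncl V P φ ∧ u = preIncl V P χ :=
  DirectLimit.exists_eq_mk₃ (fineGrain V) z w u

/-- The direct limit is an inner product space. -/
@[reducible]
noncomputable def preLimitCore {d : ℕ} (V : Vertex d) : InnerProductSpace.Core ℂ (PreLimit V) where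
  inner := preInner V
  conj_inner_symm z w := by
    obtain ⟨P, ψ, φ, rfl, rfl⟩ := exists_preIncl₂ V z w
    rw [preInner_incl, preInner_incl, inner_conj_symm]
  re_inner_nonneg z := by
    obtain ⟨P, ψ, rfl⟩ := exists_preIncl V z
    rw [preInner_incl]
    exact inner_self_nonneg
  add_left z w u := by
    obtain ⟨P, ψ, φ, χ, rfl, rfl, rfl⟩ := exists_preIncl₃ V z w u
    rw [← map_add, preInner_incl, preInner_incl, preInner_incl, inner_add_left]
  smul_left z w c := by
    obtain ⟨P, ψ, φ, rfl, rfl⟩ := exists_preIncl₂ V z w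
    rw [← map_smul, preInner_incl, preInner_incl, inner_smul_left]
  definite z h := by
    obtain ⟨P, ψ, rfl⟩ := exists_preIncl V z
    rw [preInner_incl, inner_self_eq_zero] at h
    rw [h, map_zero]

noncomputable instance instNormedAddCommGroupPreLimit {d : ℕ} (V : Vertex d) :
    NormedAddCommGroup (PreLimit V) :=
  @InnerProductSpace.Core.toNormedAddCommGroup ℂ (PreLimit V) _ _ _ (preLimitCore V)

noncomputable instance instInnerProductSpacePreLimit {d : ℕ} (V : Vertex d) :
    InnerProductSpace ℂ (PreLimit V) :=
  InnerProductSpace.ofCore (preLimitCore V).toCore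

theorem inner_preIncl {d : ℕ} (V : Vertex d) (P : DyadicPartition) (ψ φ : State d P) :
    inner ℂ (preIncl V P ψ) (preIncl V P φ) = inner ℂ ψ φ := preInner_incl V P ψ φ

theorem norm_preIncl {d : ℕ} (V : Vertex d) (P : DyadicPartition) (ψ : State d P) :
    ‖preIncl V P ψ‖ = ‖ψ‖ := by
  rw [@norm_eq_sqrt_re_inner ℂ, @norm_eq_sqrt_re_inner ℂ, inner_preIncl]

/-- The semicontinuous limit: the Hilbert space completion of the direct limit. -/
abbrev Limit {d : ℕ} (V : Vertex d) : Type := UniformSpace.Completion (PreLimit V)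

/-- The isometric embedding of the states on a partition into the semicontinuous limit. -/
noncomputable def incl {d : ℕ} (V : Vertex d) (P : DyadicPartition) :
    State d P →ₗᵢ[ℂ] Limit V :=
  (UniformSpace.Completion.toComplₗᵢ (𝕜 := ℂ) (E := PreLimit V)).comp
    ⟨preIncl V P, norm_preIncl V P⟩

/-- A point of the circle is dyadic if it is the class of a dyadic rational. -/
def IsDyadic (x : UnitAddCircle) : Prop :=
  ∃ (k : ℤ) (N : ℕ), x = (((k : ℝ) / 2 ^ N : ℝ) : UnitAddCircle)

/-- Near `x` the map `f` is affine with slope an integer power of two. -/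
def LocallyDyadicAffine (f : UnitAddCircle → UnitAddCircle) (x : UnitAddCircle) : Prop :=
  ∃ m : ℤ, ∀ᶠ u : ℝ in 𝓝 0,
    f (x + (u : UnitAddCircle)) = f x + (((2 : ℝ) ^ m * u : ℝ) : UnitAddCircle)

theorem LocallyDyadicAffine.comp {f g : UnitAddCircle → UnitAddCircle} {x : UnitAddCircle}
    (hg : LocallyDyadicAffine g x) (hf : LocallyDyadicAffine f (g x)) :
    LocallyDyadicAffine (f ∘ g) x := by
  obtain ⟨m, hm⟩ := hg
  obtain ⟨n, hn⟩ := hf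
  refine ⟨n + m, ?_⟩
  have ht : Tendsto (fun u : ℝ => (2 : ℝ) ^ m * u) (𝓝 0) (𝓝 0) := by
    have : Continuous fun u : ℝ => (2 : ℝ) ^ m * u := by fun_prop
    simpa using this.tendsto 0
  filter_upwards [hm, ht.eventually hn] with u h1 h2
  simp only [Function.comp_apply]
  rw [h1, h2, ← mul_assoc, zpow_add₀ (by norm_num)]

theorem LocallyDyadicAffine.symm {f : UnitAddCircle ≃ₜ UnitAddCircle} {x : UnitAddCircle}
    (hf : LocallyDyadicAffine f x) : LocallyDyadicAffine f.symm (f x) := by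
  obtain ⟨m, hm⟩ := hf
  refine ⟨-m, ?_⟩
  have ht : Tendsto (fun u : ℝ => (2 : ℝ) ^ (-m) * u) (𝓝 0) (𝓝 0) := by
    have : Continuous fun u : ℝ => (2 : ℝ) ^ (-m) * u := by fun_prop
    simpa using this.tendsto 0
  filter_upwards [ht.eventually hm] with u h1
  rw [f.symm_apply_eq, f.symm_apply_apply, h1, ← mul_assoc, ← zpow_add₀ (by norm_num)]
  simp

/-- Thompson's group `T`: the piecewise linear homeomorphisms of the circle that preserve the set
of dyadic points, have only finitely many breakpoints, all of them dyadic, and have slopes that are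
integer powers of two. -/
def thompsonT : Subgroup (UnitAddCircle ≃ₜ UnitAddCircle) where
  carrier := {f | (∀ x, IsDyadic (f x) ↔ IsDyadic x) ∧
    ∃ B : Finset UnitAddCircle, (∀ b ∈ B, IsDyadic b) ∧ ∀ x ∉ B, LocallyDyadicAffine f x}
  one_mem' := ⟨fun _ => Iff.rfl, ∅, by simp, fun x _ => ⟨0, by simp⟩⟩
  mul_mem' := by
    rintro f g ⟨hf, B, hB, hfB⟩ ⟨hg, C, hC, hgC⟩
    classical
    refine ⟨fun x => (hf _).trans (hg x), C ∪ B.image g.symm, ?_, ?_⟩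
    · intro b hb
      rcases Finset.mem_union.1 hb with hb | hb
      · exact hC b hb
      · obtain ⟨c, hc, rfl⟩ := Finset.mem_image.1 hb
        rw [← hg, g.apply_symm_apply]
        exact hB c hc
    · intro x hx
      rw [Finset.mem_union, not_or] at hx
      refine (hgC x hx.1).comp (hfB (g x) fun h => hx.2 ?_)
      exact Finset.mem_image.2 ⟨g x, h, g.symm_apply_apply x⟩
  inv_mem' := by
    rintro f ⟨hf, B, hB, hfB⟩
    classical
    refine ⟨fun x => ?_, B.image f, ?_, ?_⟩
    · rw [← hf (f⁻¹ x)]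
      exact iff_of_eq (congrArg IsDyadic (f.apply_symm_apply x))
    · intro b hb
      obtain ⟨c, hc, rfl⟩ := Finset.mem_image.1 hb
      exact (hf c).2 (hB c hc)
    · intro x hx
      obtain ⟨y, rfl⟩ := f.surjective x
      exact (hfB y fun h => hx (Finset.mem_image_of_mem f h)).symm

theorem len_pos (P : DyadicPartition) (p : Piece P) : 0 < len P p := by
  unfold len; positivity

theorem left_inl {l r : DyadicPartition} (p : Piece l) :
    left (split l r) (Sum.inl p) = left l p / 2 := rfl

theorem left_inr {l r : DyadicPartition} (p : Piece r) :
    left (split l r) (Sum.inr p) = (1 + left r p) / 2 := rfl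

theorem len_split_inl {l r : DyadicPartition} (p : Piece l) :
    len (split l r) (Sum.inl p) = len l p / 2 := by
  unfold len; rw [level, pow_succ]; ring

theorem len_split_inr {l r : DyadicPartition} (p : Piece r) :
    len (split l r) (Sum.inr p) = len r p / 2 := by
  unfold len; rw [level, pow_succ]; ring

theorem left_nonneg : ∀ (P : DyadicPartition) (p : Piece P), 0 ≤ left P p
  | whole, _ => le_refl _
  | split l _, Sum.inl p => by have := left_nonneg l p; rw [left]; linarith
  | split _ r, Sum.inr p => by have := left_nonneg r p; rw [left]; linarith

theorem left_add_len_le : ∀ (P : DyadicPartition) (p : Piece P), left P p + len P p ≤ 1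
  | whole, _ => by simp [left, len, level]
  | split l _, Sum.inl p => by
    have := left_add_len_le l p; rw [left, len_split_inl]; linarith
  | split _ r, Sum.inr p => by
    have := left_add_len_le r p; rw [left, len_split_inr]; linarith

/-- The intervals of a partition cover the half-open unit interval. -/
theorem exists_piece : ∀ (P : DyadicPartition) (x : ℝ), 0 ≤ x → x < 1 →
    ∃ p, left P p ≤ x ∧ x < left P p + len P p
  | whole, x, h0, h1 => ⟨(), by simpa [left] using h0, by simpa [left, len, level] using h1⟩
  | split l r, x, h0, h1 => by
    rcases lt_or_ge x (1 / 2) with h | h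
    · obtain ⟨p, hp, hp'⟩ := exists_piece l (2 * x) (by linarith) (by linarith)
      exact ⟨Sum.inl p, by rw [left]; linarith, by rw [left, len_split_inl]; linarith⟩
    · obtain ⟨p, hp, hp'⟩ := exists_piece r (2 * x - 1) (by linarith) (by linarith)
      exact ⟨Sum.inr p, by rw [left]; linarith, by rw [left, len_split_inr]; linarith⟩

/-- The intervals of a partition are disjoint. -/
theorem piece_unique : ∀ (P : DyadicPartition) (x : ℝ) (p q : Piece P),
    left P p ≤ x → x < left P p + len P p → left P q ≤ x → x < left P q + len P q → p = q
  | whole, _, _, _, _, _, _, _ => rfl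
  | split l r, x, Sum.inl p, Sum.inl q, h1, h2, h3, h4 => by
    simp only [left_inl] at h1 h2 h3 h4; rw [len_split_inl] at h2 h4
    rw [piece_unique l (2 * x) p q (by linarith) (by linarith) (by linarith) (by linarith)]
  | split l r, x, Sum.inr p, Sum.inr q, h1, h2, h3, h4 => by
    simp only [left_inr] at h1 h2 h3 h4; rw [len_split_inr] at h2 h4
    rw [piece_unique r (2 * x - 1) p q (by linarith) (by linarith) (by linarith) (by linarith)]
  | split l r, x, Sum.inl p, Sum.inr q, h1, h2, h3, h4 => by
    simp only [left_inl, left_inr] at h1 h2 h3 h4; rw [len_split_inl] at h2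
    have := left_nonneg r q
    have := left_add_len_le l p
    linarith
  | split l r, x, Sum.inr p, Sum.inl q, h1, h2, h3, h4 => by
    simp only [left_inl, left_inr] at h1 h2 h3 h4; rw [len_split_inl] at h4
    have := left_nonneg r p
    have := left_add_len_le l q
    linarith

theorem left_injective (P : DyadicPartition) : Function.Injective (left P) := fun p q h =>
  piece_unique P (left P p) p q le_rfl (by linarith [len_pos P p]) h.symm.le
    (by rw [h]; linarith [len_pos P q])

theorem nonempty_piece : ∀ P : DyadicPartition, Nonempty (Piece P)
  | whole => ⟨()⟩
  | split l _ => (nonempty_piece l).map Sum.inl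

/-- A partition is determined by its set of intervals. -/
theorem partition_ext : ∀ (P Q : DyadicPartition),
    (∀ p : Piece P, ∃ q : Piece Q, left Q q = left P p ∧ level Q q = level P p) → P = Q
  | whole, whole, _ => rfl
  | whole, split l r, h => by
    obtain ⟨q, -, hq⟩ := h ()
    rcases q with q | q <;> simp [level] at hq
  | split l r, whole, h => by
    obtain ⟨p⟩ := nonempty_piece l
    obtain ⟨q, -, hq⟩ := h (Sum.inl p)
    simp [level] at hq
  | split l r, split l' r', h => by
    have h1 : l = l' := partition_ext l l' fun p => by
      obtain ⟨q, hq, hq'⟩ := h (Sum.inl p)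
      rcases q with q | q
      · rw [left, left] at hq; rw [level, level] at hq'
        exact ⟨q, by linarith, by omega⟩
      · rw [left, left] at hq
        have := left_nonneg r' q
        have := left_add_len_le l p
        have := len_pos l p
        linarith
    have h2 : r = r' := partition_ext r r' fun p => by
      obtain ⟨q, hq, hq'⟩ := h (Sum.inr p)
      rcases q with q | q
      · rw [left, left] at hq
        have := left_nonneg r p
        have := left_add_len_le l' q
        have := len_pos l' q
        linarith
      · rw [left, left] at hq; rw [level, level] at hq'
        exact ⟨q, by linarith, by omega⟩
    rw [h1, h2]

/-- Subdivide every interval `p` of `P` according to the partition `h p`. -/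
def graft : (P : DyadicPartition) → (Piece P → DyadicPartition) → DyadicPartition
  | whole, h => h ()
  | split l r, h => split (graft l fun p => h (Sum.inl p)) (graft r fun p => h (Sum.inr p))

/-- The intervals of a subdivided partition. -/
def graftEquiv : (P : DyadicPartition) → (h : Piece P → DyadicPartition) →
    (Σ p : Piece P, Piece (h p)) ≃ Piece (graft P h)
  | whole, h => Equiv.uniqueSigma (α := Unit) fun p => Piece (h p)
  | split l r, h =>
    (Equiv.sumSigmaDistrib (α := Piece l) (β := Piece r) fun p => Piece (h p)).trans
      (Equiv.sumCongr (graftEquiv l fun p => h (Sum.inl p)) (graftEquiv r fun p => h (Sum.inr p)))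

theorem le_graft : ∀ (P : DyadicPartition) (h : Piece P → DyadicPartition), P ≤ graft P h
  | whole, _ => trivial
  | split l r, _ => ⟨le_graft l _, le_graft r _⟩

theorem exists_graft : ∀ {P Q : DyadicPartition}, P ≤ Q → ∃ h, Q = graft P h
  | whole, Q, _ => ⟨fun _ => Q, rfl⟩
  | split l r, split l' r', hPQ => by
    obtain ⟨h1, e1⟩ := exists_graft hPQ.1
    obtain ⟨h2, e2⟩ := exists_graft hPQ.2
    exact ⟨Sum.elim h1 h2, by rw [e1, e2]; rfl⟩

theorem left_graft : ∀ (P : DyadicPartition) (h : Piece P → DyadicPartition) (p : Piece P)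
    (q : Piece (h p)), left (graft P h) (graftEquiv P h ⟨p, q⟩) = left P p + len P p * left (h p) q
  | whole, h, (), q => by
    simp [left, len, level, graftEquiv, graft]
    rfl
  | split l r, h, Sum.inl p, q => by
    have := left_graft l (fun p => h (Sum.inl p)) p q
    rw [len_split_inl, left]
    change left (graft l _) (graftEquiv l (fun p => h (Sum.inl p)) ⟨p, q⟩) / 2 = _
    rw [this]; ring
  | split l r, h, Sum.inr p, q => by
    have := left_graft r (fun p => h (Sum.inr p)) p q
    rw [len_split_inr, left]
    change (1 + left (graft r _) (graftEquiv r (fun p => h (Sum.inr p)) ⟨p, q⟩)) / 2 = _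
    rw [this]; ring

theorem level_graft : ∀ (P : DyadicPartition) (h : Piece P → DyadicPartition) (p : Piece P)
    (q : Piece (h p)), level (graft P h) (graftEquiv P h ⟨p, q⟩) = level P p + level (h p) q
  | whole, h, (), q => by
    change _ = 0 + level (h ()) q
    rw [zero_add]
    rfl
  | split l r, h, Sum.inl p, q => by
    have := level_graft l (fun p => h (Sum.inl p)) p q
    rw [level]
    change level (graft l _) (graftEquiv l (fun p => h (Sum.inl p)) ⟨p, q⟩) + 1 = _
    rw [this]; ring
  | split l r, h, Sum.inr p, q => by
    have := level_graft r (fun p => h (Sum.inr p)) p q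
    rw [level]
    change level (graft r _) (graftEquiv r (fun p => h (Sum.inr p)) ⟨p, q⟩) + 1 = _
    rw [this]; ring

theorem len_graft (P : DyadicPartition) (h : Piece P → DyadicPartition) (p : Piece P)
    (q : Piece (h p)) : len (graft P h) (graftEquiv P h ⟨p, q⟩) = len P p * len (h p) q := by
  unfold len; rw [level_graft, pow_add]

theorem refineAmp_graft {d : ℕ} (V : Vertex d) : ∀ (P : DyadicPartition)
    (h : Piece P → DyadicPartition) (i : Piece P → Fin d) (k : Piece (graft P h) → Fin d),
    refineAmp V P (graft P h) i k =
      ∏ p, treeAmp V (h p) (i p) fun q => k (graftEquiv P h ⟨p, q⟩)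
  | whole, h, i, k => by
    rw [refineAmp]
    exact (Fintype.prod_unique (ι := Unit) fun p =>
      treeAmp V (h p) (i p) fun q => k (graftEquiv whole h ⟨p, q⟩)).symm
  | split l r, h, i, k => by
    have h1 := refineAmp_graft V l (fun p => h (Sum.inl p)) (fun p => i (Sum.inl p))
      (fun p => k (Sum.inl p))
    have h2 := refineAmp_graft V r (fun p => h (Sum.inr p)) (fun p => i (Sum.inr p))
      (fun p => k (Sum.inr p))
    refine Eq.trans ?_ (Fintype.prod_sum_type (α₁ := Piece l) (α₂ := Piece r) fun p =>
      treeAmp V (h p) (i p) fun q => k (graftEquiv (split l r) h ⟨p, q⟩)).symm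
    exact congrArg₂ (· * ·) h1 h2

/-- `f` maps the interval `p` of `P` affinely onto the interval `q` of `Q`. -/
def Carries (f : UnitAddCircle ≃ₜ UnitAddCircle) {P Q : DyadicPartition} (p : Piece P)
    (q : Piece Q) : Prop :=
  ∀ u : ℝ, 0 ≤ u → u < 1 → f ((left P p + len P p * u : ℝ) : UnitAddCircle) =
    ((left Q q + len Q q * u : ℝ) : UnitAddCircle)

/-- The partition `P` is good for `f`: it is mapped interval by interval onto the partition `Q`,
with the bijection `σ` between the intervals. -/
def IsGood (f : UnitAddCircle ≃ₜ UnitAddCircle) (P Q : DyadicPartition)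
    (σ : Piece P ≃ Piece Q) : Prop := ∀ p, Carries f p (σ p)

theorem circle_coe_inj {x y : ℝ} (hx : 0 ≤ x) (hx' : x < 1) (hy : 0 ≤ y) (hy' : y < 1)
    (h : (x : UnitAddCircle) = (y : UnitAddCircle)) : x = y :=
  (AddCircle.coe_eq_coe_iff_of_mem_Ico (p := (1 : ℝ)) (a := 0)
    ⟨hx, by linarith⟩ ⟨hy, by linarith⟩).1 h

theorem piece_point_bounds {P : DyadicPartition} (p : Piece P) {u : ℝ} (h0 : 0 ≤ u) (h1 : u < 1) :
    0 ≤ left P p + len P p * u ∧ left P p + len P p * u < 1 := by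
  have a := left_nonneg P p
  have b := left_add_len_le P p
  have c := len_pos P p
  constructor
  · positivity
  · nlinarith

theorem Carries.unique {f : UnitAddCircle ≃ₜ UnitAddCircle} {P Q Q' : DyadicPartition}
    {p : Piece P} {q : Piece Q} {q' : Piece Q'} (h : Carries f p q) (h' : Carries f p q') :
    left Q q = left Q' q' ∧ level Q q = level Q' q' := by
  have key : ∀ u : ℝ, 0 ≤ u → u < 1 →
      left Q q + len Q q * u = left Q' q' + len Q' q' * u := fun u h0 h1 =>
    circle_coe_inj (piece_point_bounds q h0 h1).1 (piece_point_bounds q h0 h1).2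
      (piece_point_bounds q' h0 h1).1 (piece_point_bounds q' h0 h1).2
      ((h u h0 h1).symm.trans (h' u h0 h1))
  have e1 := key 0 le_rfl one_pos
  have e2 := key (1 / 2) (by norm_num) (by norm_num)
  have e3 : len Q q = len Q' q' := by linarith
  refine ⟨by linarith, ?_⟩
  exact pow_right_injective₀ (by norm_num : (0 : ℝ) < 2⁻¹) (by norm_num) e3

theorem IsGood.symm {f : UnitAddCircle ≃ₜ UnitAddCircle} {P Q : DyadicPartition}
    {σ : Piece P ≃ Piece Q} (h : IsGood f P Q σ) : IsGood f⁻¹ Q P σ.symm := fun q u h0 h1 => by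
  have := h (σ.symm q) u h0 h1
  rw [σ.apply_symm_apply] at this
  rw [← this]
  exact f.symm_apply_apply _

theorem IsGood.mul {f g : UnitAddCircle ≃ₜ UnitAddCircle} {P Q R : DyadicPartition}
    {σ : Piece P ≃ Piece Q} {τ : Piece Q ≃ Piece R} (hg : IsGood g P Q σ) (hf : IsGood f Q R τ) :
    IsGood (f * g) P R (σ.trans τ) := fun p u h0 h1 => by
  have := hf (σ p) u h0 h1
  rw [← hg p u h0 h1] at this
  exact this

theorem isGood_one (P : DyadicPartition) : IsGood 1 P P (Equiv.refl _) := fun _ _ _ _ => rfl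

/-- The bijection between the intervals of two partitions that are subdivided in the same way. -/
def graftCongr {P Q : DyadicPartition} (σ : Piece P ≃ Piece Q) (h : Piece Q → DyadicPartition) :
    Piece (graft P fun p => h (σ p)) ≃ Piece (graft Q h) :=
  (graftEquiv P fun p => h (σ p)).symm.trans
    ((Equiv.sigmaCongrLeft (β := fun q => Piece (h q)) σ).trans (graftEquiv Q h))

theorem graftCongr_apply {P Q : DyadicPartition} (σ : Piece P ≃ Piece Q)
    (h : Piece Q → DyadicPartition) (p : Piece P) (r : Piece (h (σ p))) :
    graftCongr σ h (graftEquiv P (fun p => h (σ p)) ⟨p, r⟩) = graftEquiv Q h ⟨σ p, r⟩ := by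
  simp only [graftCongr, Equiv.trans_apply, Equiv.symm_apply_apply]
  rfl

theorem IsGood.graft {f : UnitAddCircle ≃ₜ UnitAddCircle} {P Q : DyadicPartition}
    {σ : Piece P ≃ Piece Q} (hf : IsGood f P Q σ) (h : Piece Q → DyadicPartition) :
    IsGood f (graft P fun p => h (σ p)) (graft Q h) (graftCongr σ h) := fun s u h0 h1 => by
  obtain ⟨⟨p, r⟩, rfl⟩ := (graftEquiv P fun p => h (σ p)).surjective s
  rw [graftCongr_apply, left_graft, left_graft, len_graft, len_graft]
  have hb := piece_point_bounds r h0 h1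
  have := hf p _ hb.1 hb.2
  rw [mul_add, mul_add, ← add_assoc, ← add_assoc, ← mul_assoc, ← mul_assoc] at this
  exact this

/-- The unitary that relabels the tensor factors along a bijection of the intervals. -/
noncomputable def relabel (d : ℕ) {P Q : DyadicPartition} (σ : Piece P ≃ Piece Q) :
    State d P ≃ₗᵢ[ℂ] State d Q :=
  LinearIsometryEquiv.piLpCongrLeft 2 ℂ ℂ (σ.arrowCongr (Equiv.refl (Fin d)))

theorem relabel_apply {d : ℕ} {P Q : DyadicPartition} (σ : Piece P ≃ Piece Q) (ψ : State d P)
    (k : Piece Q → Fin d) : relabel d σ ψ k = ψ fun p => k (σ p) := rfl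

theorem fineGrain_relabel {d : ℕ} (V : Vertex d) {P Q : DyadicPartition} (σ : Piece P ≃ Piece Q)
    (h : Piece Q → DyadicPartition) (ψ : State d P) :
    fineGrain V Q (graft Q h) (le_graft Q h) (relabel d σ ψ) =
      relabel d (graftCongr σ h)
        (fineGrain V P (graft P fun p => h (σ p)) (le_graft P _) ψ) := by
  ext k
  rw [relabel_apply, fineGrain_apply, fineGrain_apply]
  refine Fintype.sum_equiv (σ.symm.arrowCongr (Equiv.refl (Fin d))) _ _ fun j => ?_
  rw [relabel_apply, refineAmp_graft, refineAmp_graft, ← Equiv.prod_comp σ]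
  simp only [graftCongr_apply]
  rfl

theorem IsGood.refine {d : ℕ} (V : Vertex d) {f : UnitAddCircle ≃ₜ UnitAddCircle}
    {P Q P' : DyadicPartition} {σ : Piece P ≃ Piece Q} (hf : IsGood f P Q σ) (hP : P ≤ P') :
    ∃ (Q' : DyadicPartition) (σ' : Piece P' ≃ Piece Q'), IsGood f P' Q' σ' ∧ Q ≤ Q' ∧
      ∀ ψ, preIncl V Q' (relabel d σ' (fineGrain V P P' hP ψ)) =
        preIncl V Q (relabel d σ ψ) := by
  obtain ⟨h, rfl⟩ := exists_graft hP
  obtain ⟨h, rfl⟩ : ∃ h', h = fun p => h' (σ p) := ⟨fun q => h (σ.symm q), by simp⟩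
  refine ⟨_, _, hf.graft h, le_graft Q h, fun ψ => ?_⟩
  rw [← preIncl_fineGrain V (le_graft Q h), fineGrain_relabel]

theorem IsGood.unique {d : ℕ} (V : Vertex d) {f : UnitAddCircle ≃ₜ UnitAddCircle}
    {P Q Q' : DyadicPartition} {σ : Piece P ≃ Piece Q} {σ' : Piece P ≃ Piece Q'}
    (h : IsGood f P Q σ) (h' : IsGood f P Q' σ') (ψ : State d P) :
    preIncl V Q (relabel d σ ψ) = preIncl V Q' (relabel d σ' ψ) := by
  have e : Q = Q' := partition_ext Q Q' fun q => by
    have := (h (σ.symm q)).unique (h' (σ.symm q))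
    rw [σ.apply_symm_apply] at this
    exact ⟨_, this.1.symm, this.2.symm⟩
  subst e
  have e : σ = σ' := Equiv.ext fun p => left_injective Q ((h p).unique (h' p)).1
  rw [e]

theorem IsGood.unique' {d : ℕ} (V : Vertex d) {f : UnitAddCircle ≃ₜ UnitAddCircle}
    {P P₁ P₂ Q₁ Q₂ : DyadicPartition} {σ₁ : Piece P₁ ≃ Piece Q₁} {σ₂ : Piece P₂ ≃ Piece Q₂}
    (h₁ : IsGood f P₁ Q₁ σ₁) (h₂ : IsGood f P₂ Q₂ σ₂) (hP₁ : P ≤ P₁) (hP₂ : P ≤ P₂)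
    (ψ : State d P) :
    preIncl V Q₁ (relabel d σ₁ (fineGrain V P P₁ hP₁ ψ)) =
      preIncl V Q₂ (relabel d σ₂ (fineGrain V P P₂ hP₂ ψ)) := by
  obtain ⟨R, hR₁, hR₂⟩ := exists_common_refinement P₁ P₂
  obtain ⟨S₁, τ₁, g₁, -, e₁⟩ := h₁.refine V hR₁
  obtain ⟨S₂, τ₂, g₂, -, e₂⟩ := h₂.refine V hR₂
  rw [← e₁, ← e₂, DirectedSystem.map_map' (fineGrain V), DirectedSystem.map_map' (fineGrain V)]
  exact g₁.unique V g₂ _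

theorem circle_exists_rep (x : UnitAddCircle) : ∃ a : ℝ, 0 ≤ a ∧ a < 1 ∧ (a : UnitAddCircle) = x := by
  obtain ⟨a, ha, h⟩ := AddCircle.eq_coe_Ico x
  exact ⟨a, ha.1, ha.2, h⟩

/-- If every interval of `P` is carried to an interval of `Q`, then `P` is good for `f`. -/
theorem exists_isGood_of_carries {f : UnitAddCircle ≃ₜ UnitAddCircle} {P Q : DyadicPartition}
    (h : ∀ p : Piece P, ∃ q : Piece Q, Carries f p q) : ∃ σ, IsGood f P Q σ := by
  choose s hs using h
  have inj : Function.Injective s := fun p p' e => by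
    apply left_injective P
    have h1 := hs p 0 le_rfl one_pos
    have h2 := hs p' 0 le_rfl one_pos
    rw [e, ← h2] at h1
    have h3 := f.injective h1
    have b := piece_point_bounds p le_rfl one_pos
    have b' := piece_point_bounds p' le_rfl one_pos
    simpa using circle_coe_inj b.1 b.2 b'.1 b'.2 h3
  have surj : Function.Surjective s := fun q => by
    obtain ⟨x, h0, h1, hx⟩ := circle_exists_rep (f.symm (left Q q : UnitAddCircle))
    obtain ⟨p, hp, hp'⟩ := exists_piece P x h0 h1
    have hl := len_pos P p
    have u0 : 0 ≤ (x - left P p) / len P p := div_nonneg (by linarith) hl.le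
    have u1 : (x - left P p) / len P p < 1 := by rw [div_lt_one hl]; linarith
    have hc := hs p _ u0 u1
    rw [mul_div_cancel₀ _ hl.ne', add_sub_cancel, hx, f.apply_symm_apply] at hc
    have b := piece_point_bounds (s p) u0 u1
    have b' := piece_point_bounds q le_rfl one_pos
    rw [mul_zero, add_zero] at b'
    have e := circle_coe_inj b'.1 b'.2 b.1 b.2 hc
    have l1 := len_pos Q (s p)
    refine ⟨p, piece_unique Q (left Q q) _ _ ?_ ?_ le_rfl (by linarith [len_pos Q q])⟩
    · rw [e]; have := mul_nonneg l1.le u0; linarith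
    · rw [e]; nlinarith
  exact ⟨Equiv.ofBijective s ⟨inj, surj⟩, hs⟩

/-- The partition into `2 ^ n` intervals of equal length. -/
def regular : ℕ → DyadicPartition
  | 0 => whole
  | n + 1 => split (regular n) (regular n)

theorem level_regular : ∀ (n : ℕ) (p : Piece (regular n)), level (regular n) p = n
  | 0, _ => rfl
  | n + 1, Sum.inl p => congrArg (· + 1) (level_regular n p)
  | n + 1, Sum.inr p => congrArg (· + 1) (level_regular n p)

theorem left_regular : ∀ (n : ℕ) (p : Piece (regular n)),
    ∃ c : ℕ, left (regular n) p = (c : ℝ) / 2 ^ n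
  | 0, _ => ⟨0, by simp [regular, left]⟩
  | n + 1, Sum.inl p => by
    obtain ⟨c, hc⟩ := left_regular n p
    refine ⟨c, ?_⟩
    change left (regular n) p / 2 = _
    rw [hc, pow_succ]; field_simp
  | n + 1, Sum.inr p => by
    obtain ⟨c, hc⟩ := left_regular n p
    refine ⟨2 ^ n + c, ?_⟩
    change (1 + left (regular n) p) / 2 = _
    rw [hc, pow_succ]; push_cast; field_simp

theorem exists_regular (n : ℕ) (c : ℕ) (hc : c < 2 ^ n) :
    ∃ p : Piece (regular n), left (regular n) p = (c : ℝ) / 2 ^ n := by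
  have hc' : (c : ℝ) < 2 ^ n := by exact_mod_cast hc
  have h2 : (0 : ℝ) < 2 ^ n := by positivity
  obtain ⟨p, hp, hp'⟩ := exists_piece (regular n) ((c : ℝ) / 2 ^ n) (by positivity)
    (by rw [div_lt_one h2]; exact hc')
  obtain ⟨e, he⟩ := left_regular n p
  refine ⟨p, ?_⟩
  rw [len, level_regular, inv_pow] at hp'
  rw [he] at hp hp' ⊢
  rw [div_le_div_iff_of_pos_right h2] at hp
  rw [← one_div, ← add_div, div_lt_div_iff_of_pos_right h2] at hp'
  have h3 : e ≤ c := by exact_mod_cast hp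
  have h4 : c < e + 1 := by exact_mod_cast hp'
  have : e = c := by omega
  rw [this]

/-- A map that is locally affine with slopes powers of two on an open interval has a single slope
there, and it is affine up to the left end point. -/
theorem affine_of_locallyDyadicAffine (f : UnitAddCircle ≃ₜ UnitAddCircle) (a δ : ℝ) (hδ : 0 < δ)
    (h : ∀ u : ℝ, 0 < u → u < δ → LocallyDyadicAffine f ((a + u : ℝ) : UnitAddCircle)) :
    ∃ m : ℤ, ∀ u : ℝ, 0 ≤ u → u < δ → f ((a + u : ℝ) : UnitAddCircle) =
      f (a : UnitAddCircle) + (((2 : ℝ) ^ m * u : ℝ) : UnitAddCircle) := by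
  have loc : ∀ u : ℝ, 0 < u → u < δ → ∃ m : ℤ, ∀ᶠ v : ℝ in 𝓝 u,
      f ((a + v : ℝ) : UnitAddCircle) = f ((a + u : ℝ) : UnitAddCircle) +
        (((2 : ℝ) ^ m * (v - u) : ℝ) : UnitAddCircle) := by
    intro u h0 h1
    obtain ⟨m, hm⟩ := h u h0 h1
    refine ⟨m, ?_⟩
    have ht : Tendsto (fun v : ℝ => v - u) (𝓝 u) (𝓝 0) := by
      have : Continuous fun v : ℝ => v - u := by fun_prop
      simpa using this.tendsto u
    filter_upwards [ht.eventually hm] with v hv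
    rw [← hv, ← AddCircle.coe_add]
    congr 2; ring
  -- slopes of two affine germs that agree on an open set agree
  have slope : ∀ (c c' : UnitAddCircle) (m m' : ℤ) (w : ℝ),
      (∀ᶠ v : ℝ in 𝓝 w, c + (((2 : ℝ) ^ m * v : ℝ) : UnitAddCircle) =
        c' + (((2 : ℝ) ^ m' * v : ℝ) : UnitAddCircle)) → m = m' ∧ c = c' := by
    intro c c' m m' w hw
    have hc : ∀ᶠ v : ℝ in 𝓝 w, (((2 : ℝ) ^ m * v - (2 : ℝ) ^ m' * v : ℝ) : UnitAddCircle)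
        = c' - c := by
      filter_upwards [hw] with v hv
      rw [AddCircle.coe_sub, sub_eq_sub_iff_add_eq_add, add_comm, hv, add_comm]
    have hc0 := hc.self_of_nhds
    have hz : ∀ᶠ v : ℝ in 𝓝 w,
        ((((2 : ℝ) ^ m - (2 : ℝ) ^ m') * (v - w) : ℝ) : UnitAddCircle) = 0 := by
      filter_upwards [hc] with v hv
      have : ((2 : ℝ) ^ m - (2 : ℝ) ^ m') * (v - w) =
        ((2 : ℝ) ^ m * v - (2 : ℝ) ^ m' * v) - ((2 : ℝ) ^ m * w - (2 : ℝ) ^ m' * w) := by ring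
      rw [this, AddCircle.coe_sub, hv, hc0, sub_self]
    have hD : (2 : ℝ) ^ m - (2 : ℝ) ^ m' = 0 := by
      by_contra hD
      have ht : Tendsto (fun v : ℝ => ((2 : ℝ) ^ m - (2 : ℝ) ^ m') * (v - w)) (𝓝 w) (𝓝 0) := by
        have : Continuous fun v : ℝ => ((2 : ℝ) ^ m - (2 : ℝ) ^ m') * (v - w) := by fun_prop
        simpa using this.tendsto w
      have hs : ∀ᶠ v : ℝ in 𝓝 w, |((2 : ℝ) ^ m - (2 : ℝ) ^ m') * (v - w)| < 1 := by
        have := ht.eventually (Metric.ball_mem_nhds (0 : ℝ) one_pos)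
        filter_upwards [this] with v hv
        simpa using hv
      have hall := (hz.and hs)
      obtain ⟨ε, hε, hb⟩ := Metric.eventually_nhds_iff.1 hall
      have := @hb (w + ε / 2) (by simp [abs_of_pos hε, hε])
      obtain ⟨k, hk⟩ := AddCircle.coe_eq_zero_iff (1 : ℝ) |>.1 this.1
      rw [zsmul_eq_mul, mul_one] at hk
      rw [← hk] at this
      have hk0 : |(k : ℝ)| < 1 := this.2
      have hk1 : k = 0 := by
        have : |k| < 1 := by exact_mod_cast hk0
        exact Int.abs_lt_one_iff.1 this
      rw [hk1] at hk
      have : w + ε / 2 - w = ε / 2 := by ring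
      rw [this] at hk
      rcases mul_eq_zero.1 (by simpa using hk.symm :
        ((2 : ℝ) ^ m - (2 : ℝ) ^ m') * (ε / 2) = 0) with h | h
      · exact hD h
      · linarith
    have hm : m = m' := zpow_right_injective₀ (by norm_num : (0 : ℝ) < 2) (by norm_num)
      (sub_eq_zero.1 hD)
    refine ⟨hm, ?_⟩
    subst hm
    exact add_right_cancel hw.self_of_nhds
  obtain ⟨m, hm⟩ := loc (δ / 2) (by linarith) (by linarith)
  set c : UnitAddCircle := f ((a + δ / 2 : ℝ) : UnitAddCircle) -
    (((2 : ℝ) ^ m * (δ / 2) : ℝ) : UnitAddCircle) with hcdef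
  let S : Set ℝ := {u | ∀ᶠ v : ℝ in 𝓝 u, f ((a + v : ℝ) : UnitAddCircle) =
    c + (((2 : ℝ) ^ m * v : ℝ) : UnitAddCircle)}
  have hS : IsOpen S := isOpen_setOfPred_eventually_nhds
  have hsub : Set.Ioo 0 δ ⊆ S := by
    refine isPreconnected_Ioo.subset_of_closure_inter_subset hS ⟨δ / 2, ⟨by linarith, by linarith⟩, ?_⟩ ?_
    · change ∀ᶠ v : ℝ in 𝓝 (δ / 2), _
      filter_upwards [hm] with v hv
      rw [hv, hcdef, mul_sub, AddCircle.coe_sub]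
      abel
    · rintro u ⟨hu, h0, h1⟩
      obtain ⟨m', hm'⟩ := loc u h0 h1
      obtain ⟨V, hV, hVo, huV⟩ := eventually_nhds_iff.1 hm'
      obtain ⟨w, hwV, hwS⟩ := mem_closure_iff.1 hu V hVo huV
      have hwS' : ∀ᶠ v : ℝ in 𝓝 w, f ((a + v : ℝ) : UnitAddCircle) =
        c + (((2 : ℝ) ^ m * v : ℝ) : UnitAddCircle) := hwS
      have e := slope c (f ((a + u : ℝ) : UnitAddCircle) -
        (((2 : ℝ) ^ m' * u : ℝ) : UnitAddCircle)) m m' w (by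
          filter_upwards [hwS', hVo.mem_nhds hwV] with v hv hv'
          rw [← hv, hV v hv', mul_sub, AddCircle.coe_sub]
          abel)
      change ∀ᶠ v : ℝ in 𝓝 u, _
      filter_upwards [hm'] with v hv
      rw [hv, e.2, e.1, mul_sub, AddCircle.coe_sub]
      abel
  have hval : ∀ u ∈ Set.Ioo (0 : ℝ) δ, f ((a + u : ℝ) : UnitAddCircle) =
    c + (((2 : ℝ) ^ m * u : ℝ) : UnitAddCircle) := fun u hu =>
      (show ∀ᶠ v : ℝ in 𝓝 u, f ((a + v : ℝ) : UnitAddCircle) =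
        c + (((2 : ℝ) ^ m * v : ℝ) : UnitAddCircle) from hsub hu).self_of_nhds
  have hcl : ∀ u ∈ closure (Set.Ioo (0 : ℝ) δ), f ((a + u : ℝ) : UnitAddCircle) =
    c + (((2 : ℝ) ^ m * u : ℝ) : UnitAddCircle) := by
    have c1 : Continuous fun u : ℝ => f ((a + u : ℝ) : UnitAddCircle) :=
      f.continuous.comp ((AddCircle.continuous_mk' (1 : ℝ)).comp (by fun_prop))
    have c2 : Continuous fun u : ℝ => c + (((2 : ℝ) ^ m * u : ℝ) : UnitAddCircle) :=
      continuous_const.add ((AddCircle.continuous_mk' (1 : ℝ)).comp (by fun_prop))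
    exact fun u hu => Set.EqOn.closure (f := fun u : ℝ => f ((a + u : ℝ) : UnitAddCircle)) hval c1 c2 hu
  rw [closure_Ioo hδ.ne] at hcl
  have h0 := hcl 0 ⟨le_rfl, hδ.le⟩
  simp only [add_zero, mul_zero, AddCircle.coe_zero] at h0
  exact ⟨m, fun u hu hu' => by rw [hcl u ⟨hu, hu'.le⟩, h0]⟩

theorem IsDyadic.exists_le {x : UnitAddCircle} (h : IsDyadic x) : ∃ N₀ : ℕ, ∀ N ≥ N₀, ∃ k : ℤ,
    x = (((k : ℝ) / 2 ^ N : ℝ) : UnitAddCircle) := by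
  obtain ⟨k, N₀, rfl⟩ := h
  refine ⟨N₀, fun N hN => ⟨k * 2 ^ (N - N₀), ?_⟩⟩
  obtain ⟨e, rfl⟩ := Nat.exists_eq_add_of_le hN
  rw [Nat.add_sub_cancel_left, pow_add]
  congr 1
  push_cast
  field_simp

theorem circle_coe_eq_of_int {x y : ℝ} (k : ℤ) (h : x = y + k) :
    (x : UnitAddCircle) = (y : UnitAddCircle) := by
  rw [h, AddCircle.coe_add]
  have : ((k : ℝ) : UnitAddCircle) = 0 := (AddCircle.coe_eq_zero_iff (1 : ℝ)).2 ⟨k, by simp⟩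
  rw [this, add_zero]

/-- Every element of Thompson's group has a good partition. -/
theorem exists_isGood {f : UnitAddCircle ≃ₜ UnitAddCircle} (hf : f ∈ thompsonT) :
    ∃ P Q σ, IsGood f P Q σ := by
  obtain ⟨hdy, B, hB, hloc⟩ := hf
  -- a common denominator for the breakpoints
  obtain ⟨N, hN⟩ : ∃ N : ℕ, ∀ b ∈ B, ∃ k : ℤ, b = (((k : ℝ) / 2 ^ N : ℝ) : UnitAddCircle) := by
    have : ∀ b : UnitAddCircle, ∃ N₀ : ℕ, b ∈ B → ∀ N ≥ N₀, ∃ k : ℤ,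
        b = (((k : ℝ) / 2 ^ N : ℝ) : UnitAddCircle) := fun b => by
      by_cases hb : b ∈ B
      · obtain ⟨N₀, h⟩ := (hB b hb).exists_le
        exact ⟨N₀, fun _ => h⟩
      · exact ⟨0, fun h => absurd h hb⟩
    choose n hn using this
    exact ⟨B.sup n, fun b hb => hn b hb _ (Finset.le_sup hb)⟩
  have h2N : (0 : ℝ) < 2 ^ N := by positivity
  have hlen : ∀ p : Piece (regular N), len (regular N) p = ((2 : ℝ) ^ N)⁻¹ := fun p => by
    rw [len, level_regular, inv_pow]
  -- a single slope on each interval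
  have hslope : ∀ p : Piece (regular N), ∃ m : ℤ, ∀ u : ℝ, 0 ≤ u → u < ((2 : ℝ) ^ N)⁻¹ →
      f ((left (regular N) p + u : ℝ) : UnitAddCircle) =
        f (left (regular N) p : UnitAddCircle) + (((2 : ℝ) ^ m * u : ℝ) : UnitAddCircle) := by
    intro p
    refine affine_of_locallyDyadicAffine f _ _ (by positivity) fun u h0 h1 => hloc _ fun hb => ?_
    obtain ⟨k, hk⟩ := hN _ hb
    obtain ⟨c, hc⟩ := left_regular N p
    have hk' := sub_eq_zero.2 hk
    rw [← AddCircle.coe_sub] at hk'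
    obtain ⟨z, hz⟩ := (AddCircle.coe_eq_zero_iff (1 : ℝ)).1 hk'
    rw [zsmul_eq_mul, mul_one, hc] at hz
    have h3 : u * 2 ^ N = ((z * 2 ^ N + k - c : ℤ) : ℝ) := by
      push_cast
      rw [hz]
      field_simp
      ring
    have h4 : 0 < u * 2 ^ N := by positivity
    have h5 : u * 2 ^ N < 1 := by
      have := mul_lt_mul_of_pos_right h1 h2N
      rwa [inv_mul_cancel₀ h2N.ne'] at this
    rw [h3] at h4 h5
    have h6 : 0 < z * 2 ^ N + k - c := by exact_mod_cast h4
    have h7 : z * 2 ^ N + k - c < 1 := by exact_mod_cast h5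
    omega
  choose m hm using hslope
  have hdyl : ∀ p : Piece (regular N), IsDyadic (f (left (regular N) p : UnitAddCircle)) := by
    intro p
    obtain ⟨c, hc⟩ := left_regular N p
    exact (hdy _).2 ⟨c, N, by rw [hc]; simp⟩
  choose n hn using fun p => (hdyl p).exists_le
  -- a common denominator for the images
  obtain ⟨M, hM, hM'⟩ : ∃ M : ℕ, (∀ p, n p ≤ M) ∧ ∀ p, (N : ℤ) - m p ≤ M := by
    refine ⟨Finset.univ.sup n + Finset.univ.sup fun p => ((N : ℤ) - m p).toNat, fun p => ?_, fun p => ?_⟩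
    · exact (Finset.le_sup (f := n) (Finset.mem_univ p)).trans (Nat.le_add_right _ _)
    · have := Finset.le_sup (f := fun p => ((N : ℤ) - m p).toNat) (Finset.mem_univ p)
      have h1 := Int.self_le_toNat ((N : ℤ) - m p)
      push_cast
      have h2 : ((((N : ℤ) - m p).toNat : ℕ) : ℤ) ≤
        ((Finset.univ.sup fun p => ((N : ℤ) - m p).toNat : ℕ) : ℤ) := by exact_mod_cast this
      have h3 : (0 : ℤ) ≤ ((Finset.univ.sup n : ℕ) : ℤ) := Int.natCast_nonneg _
      omega
  choose A hA using fun p => hn p M (hM p)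
  obtain ⟨j, hj⟩ : ∃ j : Piece (regular N) → ℕ, ∀ p, (j p : ℤ) = m p - N + M :=
    ⟨fun p => (m p - N + M).toNat, fun p => Int.toNat_of_nonneg (by linarith [hM' p])⟩
  obtain ⟨σ, hσ⟩ : ∃ σ, IsGood f (graft (regular N) fun p => regular (j p)) (regular M) σ := by
    refine exists_isGood_of_carries fun s => ?_
    obtain ⟨⟨p, r⟩, rfl⟩ := (graftEquiv (regular N) fun p => regular (j p)).surjective s
    obtain ⟨c, hc⟩ := left_regular (j p) r
    have h2j : (0 : ℝ) < 2 ^ j p := by positivity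
    have h2M : (0 : ℝ) < 2 ^ M := by positivity
    have h2Mz : (0 : ℤ) < 2 ^ M := by positivity
    have hnn : 0 ≤ (A p + c) % 2 ^ M := Int.emod_nonneg _ h2Mz.ne'
    have hlt : (A p + c) % 2 ^ M < 2 ^ M := Int.emod_lt_of_pos _ h2Mz
    obtain ⟨C, hC⟩ := Int.eq_ofNat_of_zero_le hnn
    obtain ⟨q, hq⟩ := exists_regular M C (by rw [hC] at hlt; exact_mod_cast hlt)
    refine ⟨q, fun u h0 h1 => ?_⟩
    have hb := piece_point_bounds r h0 h1
    rw [left_graft, len_graft, add_assoc, mul_assoc, ← mul_add, hlen,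
      hm p _ (mul_nonneg (by positivity) hb.1)
        (by simpa using mul_lt_mul_of_pos_left hb.2 (inv_pos.2 h2N)),
      hA p, ← AddCircle.coe_add, hc, hq]
    have hlr : len (regular (j p)) r = ((2 : ℝ) ^ j p)⁻¹ := by rw [len, level_regular, inv_pow]
    have hlq : len (regular M) q = ((2 : ℝ) ^ M)⁻¹ := by rw [len, level_regular, inv_pow]
    rw [hlr, hlq]
    refine circle_coe_eq_of_int ((A p + c) / 2 ^ M) ?_
    have hpow : (2 : ℝ) ^ m p * 2 ^ M = 2 ^ N * 2 ^ j p := by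
      rw [← zpow_natCast, ← zpow_natCast, ← zpow_natCast, ← zpow_add₀ (by norm_num),
        ← zpow_add₀ (by norm_num), hj p]
      congr 1; ring
    have hdiv : ((A p : ℝ) + c) = 2 ^ M * (((A p + c) / 2 ^ M : ℤ) : ℝ) + C := by
      have := Int.mul_ediv_add_emod (A p + c) (2 ^ M)
      rw [hC] at this
      exact_mod_cast this.symm
    have hm' : (2 : ℝ) ^ m p = 2 ^ N * 2 ^ j p / 2 ^ M := by rw [← hpow]; field_simp
    rw [hm']
    have : (A p : ℝ) = 2 ^ M * (((A p + c) / 2 ^ M : ℤ) : ℝ) + C - c := by linarith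
    rw [this]
    field_simp
    ring
  exact ⟨_, _, σ, hσ⟩

/-- Every partition has a refinement that is good for a given element of Thompson's group. -/
theorem exists_isGood_ge (f : thompsonT) (P : DyadicPartition) :
    ∃ P' Q σ, IsGood (f : UnitAddCircle ≃ₜ UnitAddCircle) P' Q σ ∧ P ≤ P' := by
  obtain ⟨P₀, Q₀, σ₀, h⟩ := exists_isGood f.2
  obtain ⟨R, h1, h2⟩ := exists_common_refinement P P₀
  obtain ⟨h', rfl⟩ := exists_graft h2
  obtain ⟨h', rfl⟩ : ∃ h'', h' = fun p => h'' (σ₀ p) := ⟨fun q => h' (σ₀.symm q), by simp⟩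
  exact ⟨_, _, _, h.graft h', h1⟩

/-- The action of an element of Thompson's group on the states on a partition `P`: refine `P` to a
good partition, and move the tensor factors along. -/
noncomputable def preActOn {d : ℕ} (V : Vertex d) (f : thompsonT) (P : DyadicPartition) :
    State d P →ₗ[ℂ] PreLimit V :=
  (preIncl V (exists_isGood_ge f P).choose_spec.choose).comp
    ((relabel d (exists_isGood_ge f P).choose_spec.choose_spec.choose).toLinearEquiv.toLinearMap.comp
      (fineGrain V P _ (exists_isGood_ge f P).choose_spec.choose_spec.choose_spec.2).toLinearMap)

theorem preActOn_eq {d : ℕ} (V : Vertex d) (f : thompsonT) {P P' Q : DyadicPartition}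
    {σ : Piece P' ≃ Piece Q} (h : IsGood (f : UnitAddCircle ≃ₜ UnitAddCircle) P' Q σ)
    (hP : P ≤ P') (ψ : State d P) :
    preActOn V f P ψ = preIncl V Q (relabel d σ (fineGrain V P P' hP ψ)) :=
  IsGood.unique' V (exists_isGood_ge f P).choose_spec.choose_spec.choose_spec.1 h _ _ ψ

/-- The action of an element of Thompson's group on the direct limit. -/
noncomputable def preAct {d : ℕ} (V : Vertex d) (f : thompsonT) : PreLimit V →ₗ[ℂ] PreLimit V :=
  DirectLimit.Module.lift ℂ DyadicPartition (State d) (fineGrain V) (preActOn V f)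
    (fun P Q h ψ => by
      obtain ⟨R, S, σ, hg, hR⟩ := exists_isGood_ge f Q
      rw [preActOn_eq V f hg hR, preActOn_eq V f hg (h.trans hR),
        DirectedSystem.map_map' (fineGrain V)])

theorem preAct_preIncl {d : ℕ} (V : Vertex d) (f : thompsonT) {P Q : DyadicPartition}
    {σ : Piece P ≃ Piece Q} (h : IsGood (f : UnitAddCircle ≃ₜ UnitAddCircle) P Q σ)
    (ψ : State d P) : preAct V f (preIncl V P ψ) = preIncl V Q (relabel d σ ψ) := by
  have := preActOn_eq V f h le_rfl ψ
  rw [DirectedSystem.map_self' (fineGrain V)] at this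
  exact this

theorem preAct_one {d : ℕ} (V : Vertex d) (z : PreLimit V) : preAct V 1 z = z := by
  obtain ⟨P, ψ, rfl⟩ := exists_preIncl V z
  rw [preAct_preIncl V 1 (isGood_one P)]
  rfl

theorem preAct_mul {d : ℕ} (V : Vertex d) (f g : thompsonT) (z : PreLimit V) :
    preAct V (f * g) z = preAct V f (preAct V g z) := by
  obtain ⟨P, ψ, rfl⟩ := exists_preIncl V z
  obtain ⟨P₁, Q₁, σ₁, h₁, hP₁⟩ := exists_isGood_ge g P
  obtain ⟨Q₂, R, τ, h₂, hQ₂⟩ := exists_isGood_ge f Q₁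
  obtain ⟨P₂, σ₂, h₃, hP₂, -⟩ := h₁.symm.refine V hQ₂
  have h₄ : IsGood (g : UnitAddCircle ≃ₜ UnitAddCircle) P₂ Q₂ σ₂.symm := by
    simpa using h₃.symm
  have h₅ : IsGood ((f * g : thompsonT) : UnitAddCircle ≃ₜ UnitAddCircle) P₂ R (σ₂.symm.trans τ) :=
    h₄.mul h₂
  rw [← preIncl_fineGrain V (hP₁.trans hP₂), preAct_preIncl V _ h₅, preAct_preIncl V _ h₄,
    preAct_preIncl V _ h₂]
  rfl

theorem norm_preAct {d : ℕ} (V : Vertex d) (f : thompsonT) (z : PreLimit V) :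
    ‖preAct V f z‖ = ‖z‖ := by
  obtain ⟨P, ψ, rfl⟩ := exists_preIncl V z
  obtain ⟨P₁, Q₁, σ₁, h₁, hP₁⟩ := exists_isGood_ge f P
  rw [← preIncl_fineGrain V hP₁, preAct_preIncl V _ h₁, norm_preIncl, norm_preIncl,
    LinearIsometryEquiv.norm_map]

/-- The action of an element of Thompson's group on the direct limit, as a linear equivalence. -/
noncomputable def preActEquiv {d : ℕ} (V : Vertex d) (f : thompsonT) :
    PreLimit V ≃ₗ[ℂ] PreLimit V :=
  LinearEquiv.ofLinearMap (preAct V f) (preAct V f⁻¹)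
    (LinearMap.ext fun z => by
      rw [LinearMap.comp_apply, ← preAct_mul, mul_inv_cancel, preAct_one, LinearMap.id_apply])
    (LinearMap.ext fun z => by
      rw [LinearMap.comp_apply, ← preAct_mul, inv_mul_cancel, preAct_one, LinearMap.id_apply])

theorem denseRange_toCompl {d : ℕ} (V : Vertex d) :
    DenseRange (UniformSpace.Completion.toComplₗᵢ (𝕜 := ℂ) (E := PreLimit V)).toLinearMap :=
  UniformSpace.Completion.denseRange_coe

/-- The unitary operator by which an element of Thompson's group acts on the semicontinuous
limit. -/
noncomputable def actUnitary {d : ℕ} (V : Vertex d) (f : thompsonT) : Limit V ≃ₗᵢ[ℂ] Limit V :=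
  (preActEquiv V f).extendOfIsometry
    (UniformSpace.Completion.toComplₗᵢ (𝕜 := ℂ) (E := PreLimit V)).toLinearMap
    (UniformSpace.Completion.toComplₗᵢ (𝕜 := ℂ) (E := PreLimit V)).toLinearMap
    (denseRange_toCompl V) (denseRange_toCompl V)
    (fun z => by
      rw [LinearIsometry.coe_toLinearMap, LinearIsometry.norm_map, LinearIsometry.norm_map]
      exact norm_preAct V f z)

theorem actUnitary_coe {d : ℕ} (V : Vertex d) (f : thompsonT) (z : PreLimit V) :
    actUnitary V f (z : Limit V) = (preAct V f z : Limit V) :=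
  LinearEquiv.extendOfIsometry_eq _ _ _ (denseRange_toCompl V) (denseRange_toCompl V) _ z

/-- The unitary representation of Thompson's group `T` on the semicontinuous limit. -/
noncomputable def unitaryRep {d : ℕ} (V : Vertex d) : thompsonT →* (Limit V ≃ₗᵢ[ℂ] Limit V) where
  toFun := actUnitary V
  map_one' := LinearIsometryEquiv.ext fun x => by
    induction x using UniformSpace.Completion.induction_on with
    | hp => exact isClosed_eq (LinearIsometryEquiv.continuous _) (LinearIsometryEquiv.continuous _)
    | ih z => rw [actUnitary_coe, preAct_one]; rfl
  map_mul' f g := LinearIsometryEquiv.ext fun x => by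
    induction x using UniformSpace.Completion.induction_on with
    | hp => exact isClosed_eq (LinearIsometryEquiv.continuous _) (LinearIsometryEquiv.continuous _)
    | ih z =>
      change actUnitary V (f * g) (z : Limit V) = actUnitary V f (actUnitary V g (z : Limit V))
      rw [actUnitary_coe, actUnitary_coe, actUnitary_coe, preAct_mul]

/-- For a partition `P` good for `f`, the operator `U(f)` sends the class of a state on `P` to the
class of the relabelled state on the image partition. -/
theorem unitaryRep_incl {d : ℕ} (V : Vertex d) (f : thompsonT) {P Q : DyadicPartition}
    {σ : Piece P ≃ Piece Q} (h : IsGood (f : UnitAddCircle ≃ₜ UnitAddCircle) P Q σ)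
    (ψ : State d P) : unitaryRep V f (incl V P ψ) = incl V Q (relabel d σ ψ) := by
  change actUnitary V f (preIncl V P ψ : Limit V) = (preIncl V Q (relabel d σ ψ) : Limit V)
  rw [actUnitary_coe, preAct_preIncl V f h]

/-- The vacuum on the partition `[0,1/4], [1/4,1/2], [1/2,1]`: the tensor `V` placed in the ideal
triangle with vertices `0, 1/4, 1/2`, its outgoing legs at the first two intervals and its incoming
leg (bent by means of the standard basis) at the third, normalized to a unit vector. -/
noncomputable def vacuumState {d : ℕ} (V : Vertex d) :
    State d (split (split whole whole) whole) :=
  WithLp.toLp 2 fun k => ((Real.sqrt d)⁻¹ : ℝ) *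
    vertexMatrix V (k (Sum.inl (Sum.inl ())), k (Sum.inl (Sum.inr ()))) (k (Sum.inr ()))

/-- The vacuum vector of the semicontinuous limit. -/
noncomputable def vacuum {d : ℕ} (V : Vertex d) : Limit V := incl V _ (vacuumState V)

/-- The map `E(A) = V† (A ⊗ 1) V` on matrices. -/
noncomputable def ascend {d : ℕ} (V : Vertex d) (A : Matrix (Fin d) (Fin d) ℂ) :
    Matrix (Fin d) (Fin d) ℂ :=
  (vertexMatrix V)ᴴ * (A ⊗ₖ (1 : Matrix (Fin d) (Fin d) ℂ)) * vertexMatrix V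

/-- The matrix `A` acting on the tensor factor of the interval `p`. -/
noncomputable def onPiece {d : ℕ} (P : DyadicPartition) (p : Piece P)
    (A : Matrix (Fin d) (Fin d) ℂ) : Module.End ℂ (State d P) where
  toFun ψ := WithLp.toLp 2 fun k => ∑ a, A (k p) a * ψ (Function.update k p a)
  map_add' ψ φ := by
    ext k; simp [mul_add, Finset.sum_add_distrib]
  map_smul' c ψ := by
    ext k; simp [Finset.mul_sum, mul_left_comm]

/-- The representative in `[0,1)` of a point of the circle. -/
noncomputable def rep (z : UnitAddCircle) : ℝ := (AddCircle.equivIco (1 : ℝ) 0 z : ℝ)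

open Classical in
/-- The discretized field operator at `z` with respect to the partition `P`, for an operator `A`
with weight `c`: the sum over the intervals `I` of `P` of `χ_I(z) c ^ (log₂ |I|) A_I`. Here
`log₂ |I|` is minus the level of `I`, and the intervals are half open. -/
noncomputable def fieldOp {d : ℕ} (A : Matrix (Fin d) (Fin d) ℂ) (c : ℂ) (P : DyadicPartition)
    (z : UnitAddCircle) : Module.End ℂ (State d P) :=
  ∑ p : Piece P, if rep z ∈ Set.Ico (left P p) (left P p + len P p) then
    c ^ (-(level P p : ℤ)) • onPiece P p A else 0

/-- The product `φ^{α₁}(z₁) ⋯ φ^{αₙ}(zₙ)` of discretized field operators. -/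
noncomputable def fieldProd {d n : ℕ} {ι : Type*} (μ : ι → Matrix (Fin d) (Fin d) ℂ) (lam : ι → ℂ)
    (α : Fin n → ι) (P : DyadicPartition) (z : Fin n → UnitAddCircle) : Module.End ℂ (State d P) :=
  (List.ofFn fun j => fieldOp (μ (α j)) (lam (α j)) P (z j)).prod

open Classical in
/-- The expectation value `⟨ψ_P, φ^{α₁}(z₁) ⋯ φ^{αₙ}(zₙ) ψ_P⟩` where `ψ_P` is the representative of
`ψ` on the partition `P`, if there is one (the value is set to zero otherwise). -/
noncomputable def expectation {d n : ℕ} (V : Vertex d) {ι : Type*}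
    (μ : ι → Matrix (Fin d) (Fin d) ℂ) (lam : ι → ℂ) (α : Fin n → ι) (ψ : Limit V)
    (z : Fin n → UnitAddCircle) (P : DyadicPartition) : ℂ :=
  if h : ∃ φ : State d P, incl V P φ = ψ then
    inner ℂ h.choose (fieldProd μ lam α P z h.choose) else 0

/-- The `n`-point function in the state `ψ`: the limit of the expectation values along the directed
set of standard dyadic partitions. -/
noncomputable def nPoint {d n : ℕ} (V : Vertex d) {ι : Type*}
    (μ : ι → Matrix (Fin d) (Fin d) ℂ) (lam : ι → ℂ) (α : Fin n → ι) (ψ : Limit V)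
    (z : Fin n → UnitAddCircle) : ℂ :=
  limUnder atTop (expectation V μ lam α ψ z)

/-- The `n`-point function in the state `ψ` is well defined at `z`: the state `ψ` has
representatives on all sufficiently fine partitions, and the expectation values converge. -/
def HasNPoint {d n : ℕ} (V : Vertex d) {ι : Type*}
    (μ : ι → Matrix (Fin d) (Fin d) ℂ) (lam : ι → ℂ) (α : Fin n → ι) (ψ : Limit V)
    (z : Fin n → UnitAddCircle) : Prop :=
  (∀ᶠ P in atTop, ψ ∈ Set.range (incl V P)) ∧
    Tendsto (expectation V μ lam α ψ z) atTop (𝓝 (nPoint V μ lam α ψ z))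

/-- The scaling dimension `-Re log₂ c`. -/
noncomputable def scalingDim (c : ℂ) : ℝ := -(Complex.log c / Real.log 2).re

/-- A circle map as a function on the real line with values in `[0,1)`. -/
noncomputable def circleFun (f : UnitAddCircle → UnitAddCircle) (t : ℝ) : ℝ :=
  rep (f (t : UnitAddCircle))

/-- The derivative from the right of a circle map. -/
noncomputable def rightDeriv (f : UnitAddCircle → UnitAddCircle) (t : ℝ) : ℝ :=
  derivWithin (circleFun f) (Set.Ici t) t

end ThompsonField

open ThompsonField

/-! The discretized correlation functions do not merely converge: along refinements they become
constant. Coarse-graining an operator through one vertex turns `A ⊗ 1` into `E(A)`, and the swap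
symmetry of `V` gives the same result for `1 ⊗ A` (`ascend_swap`), while `V†V = 1` erases vertices
that carry no operator. An eigenmatrix sitting on a leaf at depth `k` of any tree therefore
coarse-grains to `λ ^ k` times itself at the root, whatever the path to the leaf
(`ascendTree_mulSingle`). The weight `λ ^ (log₂ |I|)` in the field is chosen to absorb this factor.

With several fields this argument works tree by tree, provided that no two of them sit in the same
interval: fine-graining is a tensor product of trees over the intervals of `P`, so its adjoint takes
product operators to product operators (`inner_fineGrain_tensorOp`). Hence for every state with a
representative on some partition separating the points, the expectation value on that partition is
already the limit (`inner_fieldProd_fineGrain`, `hasNPoint_and_eq`).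

For covariance, take one partition `P` that separates the points, refines the partition on which the
vacuum is defined, and is mapped by `f` interval by interval onto a partition `Q`. There `U(f)` only
relabels tensor factors, so the operators inserted for `Ω` and for `U(f)Ω` are conjugate under a
unitary (`prod_onPiece_relabel`), and the two correlation functions differ only in their weights. At
the `j`-th point the weights differ by a power of `λ` whose exponent is a difference of levels, and
the same difference is `log₂` of the slope of `f` there (`Carries.hasDerivWithinAt`). The last two
formulas follow by rewriting `|λ|` as a power of `2` with exponent minus the scaling dimension. -/

namespace ThompsonField

open DyadicPartition

/-! ### Product operators on the states of a partition -/

/-- The tensor product of the matrices `B p` over the intervals `p` of `P`, acting on states. -/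
noncomputable def tensorOp {d : ℕ} (P : DyadicPartition) :
    (Piece P → Matrix (Fin d) (Fin d) ℂ) →* Module.End ℂ (State d P) where
  toFun B :=
    { toFun := fun ψ => WithLp.toLp 2 fun k => ∑ k', (∏ p, B p (k p) (k' p)) * ψ k'
      map_add' := fun ψ φ => by ext k; simp [mul_add, Finset.sum_add_distrib]
      map_smul' := fun c ψ => by ext k; simp [Finset.mul_sum, mul_left_comm] }
  map_one' := by
    ext ψ k
    simp [Matrix.one_apply, Fintype.prod_ite_zero, ← funext_iff]
  map_mul' B C := by
    refine LinearMap.ext fun ψ => ?_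
    ext k
    -- Expanding the product over intervals of the sums in each matrix product gives one sum over
    -- intermediate configurations, which is the composition of the two kernels.
    simp only [LinearMap.coe_mk, AddHom.coe_mk, Module.End.mul_apply, Pi.mul_apply,
      Matrix.mul_apply, Finset.prod_univ_sum, Fintype.piFinset_univ, Finset.prod_mul_distrib,
      Finset.sum_mul, Finset.mul_sum]
    rw [Finset.sum_comm]
    exact Finset.sum_congr rfl fun _ _ => Finset.sum_congr rfl fun _ _ => mul_assoc _ _ _

theorem tensorOp_apply {d : ℕ} (P : DyadicPartition) (B : Piece P → Matrix (Fin d) (Fin d) ℂ)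
    (ψ : State d P) (k : Piece P → Fin d) :
    tensorOp P B ψ k = ∑ k', (∏ p, B p (k p) (k' p)) * ψ k' := rfl

/-- Identity factors away from `p` kill every configuration `k'` that differs from `k` elsewhere,
which leaves the sum over the value at `p`. This lets one-site operators be handled by the
multiplicativity of `tensorOp`. -/
theorem tensorOp_mulSingle {d : ℕ} (P : DyadicPartition) (p : Piece P)
    (A : Matrix (Fin d) (Fin d) ℂ) : tensorOp P (Pi.mulSingle p A) = onPiece P p A := by
  refine LinearMap.ext fun ψ => ?_
  ext k
  rw [tensorOp_apply]
  change _ = ∑ a, A (k p) a * ψ (Function.update k p a)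
  symm
  refine Finset.sum_of_injOn (fun a => Function.update k p a) ?_ (by simp) ?_ ?_
  · exact fun a _ b _ h => by simpa using congrFun h p
  · intro k' _ hk'
    -- A configuration outside the image of `a ↦ Function.update k p a` disagrees with `k` at some
    -- `q ≠ p`, where the factor is an off-diagonal entry of the identity.
    obtain ⟨q, hq, hne⟩ : ∃ q, q ≠ p ∧ k q ≠ k' q := by
      by_contra! hcon
      refine hk' ⟨k' p, by simp, ?_⟩
      ext1 q
      by_cases h : q = p
      · subst h; simp
      · simp [h, hcon q h]
    rw [Finset.prod_eq_zero (Finset.mem_univ q), zero_mul]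
    rw [Pi.mulSingle_eq_of_ne hq, Matrix.one_apply_ne hne]
  · intro a _
    rw [Fintype.prod_eq_single p fun q hq => by simp [hq]]
    simp

theorem tensorOp_relabel {d : ℕ} {P Q : DyadicPartition} (σ : Piece P ≃ Piece Q)
    (B : Piece Q → Matrix (Fin d) (Fin d) ℂ) (ψ : State d P) :
    tensorOp Q B (relabel d σ ψ) = relabel d σ (tensorOp P (B ∘ σ) ψ) := by
  ext k
  rw [relabel_apply, tensorOp_apply, tensorOp_apply]
  refine Fintype.sum_equiv (σ.symm.arrowCongr (Equiv.refl (Fin d))) _ _ fun j => ?_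
  rw [relabel_apply, ← Equiv.prod_comp σ]
  rfl

theorem onPiece_relabel {d : ℕ} {P Q : DyadicPartition} (σ : Piece P ≃ Piece Q) (p : Piece P)
    (A : Matrix (Fin d) (Fin d) ℂ) (ψ : State d P) :
    onPiece Q (σ p) A (relabel d σ ψ) = relabel d σ (onPiece P p A ψ) := by
  rw [← tensorOp_mulSingle, ← tensorOp_mulSingle, tensorOp_relabel]
  congr 3
  ext1 q
  by_cases h : q = p
  · subst h; simp
  · simp [h]

/-! ### Coarse-graining operators through trees -/

/-- The matrix obtained by coarse-graining a tensor product of matrices through the tree of `P`. -/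
noncomputable def ascendTree {d : ℕ} (V : Vertex d) :
    (P : DyadicPartition) → (Piece P → Matrix (Fin d) (Fin d) ℂ) → Matrix (Fin d) (Fin d) ℂ
  | whole, B => B ()
  | split l r, B => (vertexMatrix V)ᴴ *
      (ascendTree V l (fun p => B (Sum.inl p)) ⊗ₖ ascendTree V r (fun p => B (Sum.inr p))) *
      vertexMatrix V

theorem vertexMatrix_conjTranspose_mul_self {d : ℕ} (V : Vertex d) :
    (vertexMatrix V)ᴴ * vertexMatrix V = 1 := by
  ext i j
  rw [Matrix.mul_apply, Matrix.one_apply, ← vertexMatrix_isometry V i j]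
  rfl

theorem ascendTree_one {d : ℕ} (V : Vertex d) : ∀ P, ascendTree V P (fun _ => 1) = 1
  | whole => rfl
  | split l r => by
    rw [ascendTree, ascendTree_one V l, ascendTree_one V r, Matrix.one_kronecker_one,
      Matrix.mul_one, vertexMatrix_conjTranspose_mul_self]

/-- Exchanging the two legs conjugates `A ⊗ 1` into `1 ⊗ A` and fixes `V`. This is where the
symmetry of the tensor enters: left and right halves become equivalent. -/
theorem ascend_swap {d : ℕ} (V : Vertex d)
    (hswap : ∀ (φ : EuclideanSpace ℂ (Fin d)) (a b : Fin d), V φ (a, b) = V φ (b, a))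
    (A : Matrix (Fin d) (Fin d) ℂ) :
    (vertexMatrix V)ᴴ * ((1 : Matrix (Fin d) (Fin d) ℂ) ⊗ₖ A) * vertexMatrix V = ascend V A := by
  have hV : (vertexMatrix V).submatrix (Equiv.prodComm _ _) (Equiv.refl _) = vertexMatrix V := by
    ext ⟨a, b⟩ i
    exact hswap _ _ _
  have hK : (A ⊗ₖ (1 : Matrix (Fin d) (Fin d) ℂ)).submatrix (Equiv.prodComm _ _)
      (Equiv.prodComm _ _) = (1 : Matrix (Fin d) (Fin d) ℂ) ⊗ₖ A := by
    ext ⟨a, b⟩ ⟨a', b'⟩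
    simp [mul_comm]
  rw [ascend, ← hK]
  -- The swap is inserted into both outer factors of the left-hand side; the index `2` below skips
  -- the copy of `V` that this first rewrite leaves behind. The reindexings at the two inner
  -- products then cancel.
  nth_rw 1 [← hV]
  nth_rw 2 [← hV]
  rw [Matrix.conjTranspose_submatrix, Matrix.submatrix_mul_equiv, Matrix.submatrix_mul_equiv]
  rfl

theorem ascend_smul {d : ℕ} (V : Vertex d) (c : ℂ) (A : Matrix (Fin d) (Fin d) ℂ) :
    ascend V (c • A) = c • ascend V A := by
  simp [ascend, Matrix.smul_kronecker]

theorem mulSingle_comp_of_injective {ι κ M : Type*} [DecidableEq ι] [DecidableEq κ] [One M]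
    {g : ι → κ} (hg : Function.Injective g) (p : ι) (A : M) :
    (fun q => Pi.mulSingle (M := fun _ => M) (g p) A (g q)) = Pi.mulSingle p A := by
  ext1 q
  by_cases h : q = p
  · subst h; simp
  · rw [Pi.mulSingle_eq_of_ne h, Pi.mulSingle_eq_of_ne fun e => h (hg e)]

/-- Each branching on the path from the root to `r` contributes one application of `E`, hence one
factor `c`; subtrees off the path collapse to the identity. The number of branchings on the path is
the level of `r`. -/
theorem ascendTree_mulSingle {d : ℕ} (V : Vertex d)
    (hswap : ∀ (φ : EuclideanSpace ℂ (Fin d)) (a b : Fin d), V φ (a, b) = V φ (b, a))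
    {A : Matrix (Fin d) (Fin d) ℂ} {c : ℂ} (hA : ascend V A = c • A) :
    ∀ (P : DyadicPartition) (r : Piece P),
      ascendTree V P (Pi.mulSingle r A) = c ^ level P r • A
  | whole, () => by
    rw [ascendTree, show level whole () = 0 from rfl, pow_zero, one_smul]
    exact Pi.mulSingle_eq_same (M := fun _ : Piece whole => Matrix (Fin d) (Fin d) ℂ) () A
  | split l r, Sum.inl p => by
    have h1 : (fun q => Pi.mulSingle (M := fun _ : Piece (split l r) => Matrix (Fin d) (Fin d) ℂ)
        (Sum.inl p) A (Sum.inl q)) = Pi.mulSingle p A :=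
      mulSingle_comp_of_injective (κ := Piece (split l r)) Sum.inl_injective p A
    have h2 : (fun q => Pi.mulSingle (M := fun _ : Piece (split l r) => Matrix (Fin d) (Fin d) ℂ)
        (Sum.inl p) A (Sum.inr q)) = fun _ => 1 := by
      ext1 q
      exact Pi.mulSingle_eq_of_ne (by rintro ⟨⟩) _
    rw [ascendTree, h1, h2, ascendTree_one, ascendTree_mulSingle V hswap hA l p, level]
    change ascend V _ = _
    rw [ascend_smul, hA, smul_smul, pow_succ]
  | split l r, Sum.inr p => by
    have h1 : (fun q => Pi.mulSingle (M := fun _ : Piece (split l r) => Matrix (Fin d) (Fin d) ℂ)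
        (Sum.inr p) A (Sum.inr q)) = Pi.mulSingle p A :=
      mulSingle_comp_of_injective (κ := Piece (split l r)) Sum.inr_injective p A
    have h2 : (fun q => Pi.mulSingle (M := fun _ : Piece (split l r) => Matrix (Fin d) (Fin d) ℂ)
        (Sum.inr p) A (Sum.inl q)) = fun _ => 1 := by
      ext1 q
      exact Pi.mulSingle_eq_of_ne (by rintro ⟨⟩) _
    rw [ascendTree, h1, h2, ascendTree_one, ascendTree_mulSingle V hswap hA r p, level,
      ascend_swap V hswap, ascend_smul, hA, smul_smul, pow_succ]

/-- Brings the root indices outside and pairs the bra and ket configurations of each half, so that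
the summand factors into a left and a right part. -/
theorem sum_six_comm {A B A' B' C D : Type*} [Fintype A] [Fintype B] [Fintype A'] [Fintype B']
    [Fintype C] [Fintype D] (G : A → B → A' → B' → C → D → ℂ) :
    ∑ a, ∑ b, ∑ a', ∑ b', ∑ c, ∑ e, G a b a' b' c e =
      ∑ c, ∑ e, ∑ a, ∑ a', ∑ b, ∑ b', G a b a' b' c e := by
  calc _ = ∑ x : A × B × A' × B' × C × D,
        G x.1 x.2.1 x.2.2.1 x.2.2.2.1 x.2.2.2.2.1 x.2.2.2.2.2 := by
        simp only [Fintype.sum_prod_type]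
    _ = ∑ x : C × D × A × A' × B × B',
        G x.2.2.1 x.2.2.2.2.1 x.2.2.2.1 x.2.2.2.2.2 x.1 x.2.1 :=
        Fintype.sum_equiv
          { toFun := fun x => (x.2.2.2.2.1, x.2.2.2.2.2, x.1, x.2.2.1, x.2.1, x.2.2.2.1)
            invFun := fun x => (x.2.2.1, x.2.2.2.2.1, x.2.2.2.1, x.2.2.2.2.2, x.1, x.2.1)
            left_inv := fun _ => rfl
            right_inv := fun _ => rfl } _ _ fun _ => rfl
    _ = _ := by simp only [Fintype.sum_prod_type]

/-- Entrywise form of `T† (⊗ B) T` for the tree tensor `T`. Peeling off the root vertex splits `T`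
into two independent trees, which is the recursion that defines `ascendTree`. -/
theorem sum_treeAmp {d : ℕ} (V : Vertex d) : ∀ (P : DyadicPartition)
    (B : Piece P → Matrix (Fin d) (Fin d) ℂ) (i j : Fin d),
    ∑ k, ∑ k', conj (treeAmp V P i k) * ((∏ p, B p (k p) (k' p)) * treeAmp V P j k') =
      ascendTree V P B i j
  | whole, B, i, j => by
    have hp : ∀ F : Piece whole → ℂ, ∏ p, F p = F () := fun F =>
      Fintype.prod_unique (ι := Unit) F
    simp only [sum_piece_whole, hp]
    simp [treeAmp, ascendTree]
  | split l r, B, i, j => by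
    have hp : ∀ F : Piece (split l r) → ℂ,
        ∏ p, F p = (∏ p, F (Sum.inl p)) * ∏ p, F (Sum.inr p) := fun F =>
      Fintype.prod_sum_type (α₁ := Piece l) (α₂ := Piece r) F
    simp only [sum_piece_split, hp]
    simp only [treeAmp, Sum.elim_inl, Sum.elim_inr, map_sum, map_mul]
    -- Here `ab` and `cd` are the leg indices of the two copies of `V` at the root, one in the bra
    -- and one in the ket.
    have hR : ascendTree V (split l r) B i j = ∑ ab : Fin d × Fin d, ∑ cd : Fin d × Fin d,
        conj (vertexMatrix V ab i) * vertexMatrix V cd j *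
          (ascendTree V l (fun p => B (Sum.inl p)) ab.1 cd.1 *
            ascendTree V r (fun p => B (Sum.inr p)) ab.2 cd.2) := by
      simp only [ascendTree, Matrix.mul_apply, Matrix.conjTranspose_apply,
        Matrix.kroneckerMap_apply, Finset.sum_mul]
      rw [Finset.sum_comm]
      exact Finset.sum_congr rfl fun ab _ => Finset.sum_congr rfl fun cd _ => by
        rw [RCLike.star_def]; ring
    rw [hR]
    simp only [← sum_treeAmp V l, ← sum_treeAmp V r]
    refine Eq.trans ?_ ((sum_six_comm fun a b a' b' (ab cd : Fin d × Fin d) =>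
      conj (vertexMatrix V ab i) * (conj (treeAmp V l ab.1 a) * conj (treeAmp V r ab.2 b)) *
        ((∏ p, B (Sum.inl p) (a p) (a' p)) * (∏ p, B (Sum.inr p) (b p) (b' p)) *
          (vertexMatrix V cd j * (treeAmp V l cd.1 a' * treeAmp V r cd.2 b')))).trans ?_)
    · refine Finset.sum_congr rfl fun a _ => Finset.sum_congr rfl fun b _ => ?_
      refine Finset.sum_congr rfl fun a' _ => Finset.sum_congr rfl fun b' _ => ?_
      rw [Finset.mul_sum, Finset.sum_mul_sum]
    · refine Finset.sum_congr rfl fun ab _ => Finset.sum_congr rfl fun cd _ => ?_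
      rw [Finset.sum_mul, Finset.mul_sum]
      refine Finset.sum_congr rfl fun a _ => ?_
      rw [Finset.sum_mul, Finset.mul_sum]
      refine Finset.sum_congr rfl fun a' _ => ?_
      rw [Finset.mul_sum, Finset.mul_sum]
      refine Finset.sum_congr rfl fun b _ => ?_
      rw [Finset.mul_sum, Finset.mul_sum]
      exact Finset.sum_congr rfl fun b' _ => by ring


/-- The fine-graining map is a tensor product of trees over the intervals of `P`, so the sandwich
factorizes into one coarse-grained matrix per interval. -/
theorem sum_refineAmp {d : ℕ} (V : Vertex d) : ∀ (P : DyadicPartition)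
    (h : Piece P → DyadicPartition) (B : Piece (graft P h) → Matrix (Fin d) (Fin d) ℂ)
    (i j : Piece P → Fin d),
    ∑ k, ∑ k', conj (refineAmp V P (graft P h) i k) *
      ((∏ q, B q (k q) (k' q)) * refineAmp V P (graft P h) j k') =
      ∏ p, ascendTree V (h p) (fun q => B (graftEquiv P h ⟨p, q⟩)) (i p) (j p)
  | whole, h, B, i, j => by
    refine (sum_treeAmp V (h ()) B (i ()) (j ())).trans ?_
    exact (Fintype.prod_unique (ι := Unit) fun p =>
      ascendTree V (h p) (fun q => B (graftEquiv whole h ⟨p, q⟩)) (i p) (j p)).symm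
  | split l r, h, B, i, j => by
    have h1 := sum_refineAmp V l (fun p => h (Sum.inl p)) (fun p => B (Sum.inl p))
      (fun p => i (Sum.inl p)) (fun p => j (Sum.inl p))
    have h2 := sum_refineAmp V r (fun p => h (Sum.inr p)) (fun p => B (Sum.inr p))
      (fun p => i (Sum.inr p)) (fun p => j (Sum.inr p))
    refine Eq.trans ?_ ((congrArg₂ (· * ·) h1 h2).trans
      (Fintype.prod_sum_type (α₁ := Piece l) (α₂ := Piece r) fun p =>
        ascendTree V (h p) (fun q => B (graftEquiv (split l r) h ⟨p, q⟩)) (i p) (j p)).symm)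
    have hp : ∀ F : Piece (graft (split l r) h) → ℂ,
        ∏ p, F p = (∏ p, F (Sum.inl p)) * ∏ p, F (Sum.inr p) := fun F =>
      Fintype.prod_sum_type (α₁ := Piece (graft l _)) (α₂ := Piece (graft r _)) F
    simp only [hp]
    refine (sum_piece_split _).trans ((Finset.sum_congr rfl fun a _ =>
      Finset.sum_congr rfl fun b _ => sum_piece_split _).trans ?_)
    simp only [Finset.sum_mul_sum]
    refine Finset.sum_congr rfl fun a _ => Finset.sum_congr rfl fun b _ => ?_
    refine Finset.sum_congr rfl fun a' _ => Finset.sum_congr rfl fun b' _ => ?_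
    simp only [graft, refineAmp, Sum.elim_inl, Sum.elim_inr, map_mul]
    ring

theorem sum_four_comm {A B C D : Type*} [Fintype A] [Fintype B] [Fintype C] [Fintype D]
    (G : A → B → C → D → ℂ) :
    ∑ a, ∑ b, ∑ c, ∑ e, G a b c e = ∑ c, ∑ e, ∑ a, ∑ b, G a b c e := by
  calc _ = ∑ x : A × B, ∑ y : C × D, G x.1 x.2 y.1 y.2 := by simp only [Fintype.sum_prod_type]
    _ = ∑ y : C × D, ∑ x : A × B, G x.1 x.2 y.1 y.2 := Finset.sum_comm
    _ = _ := by simp only [Fintype.sum_prod_type]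

/-- Heisenberg picture: the adjoint of fine-graining carries product operators to product operators,
each factor being obtained from its own subtree. -/
theorem inner_fineGrain_tensorOp {d : ℕ} (V : Vertex d) (P : DyadicPartition)
    (h : Piece P → DyadicPartition) (B : Piece (graft P h) → Matrix (Fin d) (Fin d) ℂ)
    (ψ φ : State d P) :
    inner ℂ (fineGrain V P (graft P h) (le_graft P h) ψ)
      (tensorOp (graft P h) B (fineGrain V P (graft P h) (le_graft P h) φ)) =
    inner ℂ ψ (tensorOp P (fun p => ascendTree V (h p) fun q => B (graftEquiv P h ⟨p, q⟩)) φ) := by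
  simp only [PiLp.inner_apply, RCLike.inner_apply, tensorOp_apply, fineGrain_apply,
    ← sum_refineAmp, map_sum, map_mul]
  refine Eq.trans ?_ ((sum_four_comm fun (k k' : Piece (graft P h) → Fin d)
    (i j : Piece P → Fin d) => (conj (refineAmp V P (graft P h) i k) *
      ((∏ q, B q (k q) (k' q)) * refineAmp V P (graft P h) j k')) * φ j * (starRingEnd ℂ) (ψ i)).trans ?_)
  · refine Finset.sum_congr rfl fun k _ => ?_
    rw [Finset.sum_mul]
    refine Finset.sum_congr rfl fun k' _ => ?_
    rw [Finset.mul_sum]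
    refine Finset.sum_congr rfl fun i _ => ?_
    rw [Finset.mul_sum, Finset.sum_mul]
    exact Finset.sum_congr rfl fun j _ => by ring
  · refine Finset.sum_congr rfl fun i _ => ?_
    rw [Finset.sum_mul]
    refine Finset.sum_congr rfl fun j _ => ?_
    simp only [Finset.sum_mul]

/-! ### Ordered products of field operators -/

theorem list_ofFn_prod_smul {R M : Type*} [CommMonoid R] [Monoid M] [MulAction R M]
    [IsScalarTower R M M] [SMulCommClass R M M] : ∀ {n : ℕ} (c : Fin n → R) (X : Fin n → M),
    (List.ofFn fun j => c j • X j).prod = (∏ j, c j) • (List.ofFn X).prod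
  | 0, _, _ => by simp
  | n + 1, c, X => by
    rw [List.ofFn_succ, List.ofFn_succ, List.prod_cons, List.prod_cons, Fin.prod_univ_succ,
      list_ofFn_prod_smul (fun j => c j.succ), smul_mul_smul_comm]

theorem list_ofFn_prod_apply {ι M : Type*} [Monoid M] {n : ℕ} (X : Fin n → ι → M) (i : ι) :
    (List.ofFn X).prod i = (List.ofFn fun j => X j i).prod := by
  refine (map_list_prod (Pi.evalMonoidHom (fun _ => M) i) (List.ofFn X)).trans ?_
  rw [List.map_ofFn]
  rfl

theorem list_ofFn_prod_eq_single {M : Type*} [Monoid M] : ∀ {n : ℕ} (X : Fin n → M) (j : Fin n),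
    (∀ i, i ≠ j → X i = 1) → (List.ofFn X).prod = X j
  | 0, _, j, _ => j.elim0
  | n + 1, X, j, h => by
    rw [List.ofFn_succ, List.prod_cons]
    induction j using Fin.cases with
    | zero =>
      rw [List.prod_eq_one, mul_one]
      intro y hy
      obtain ⟨i, rfl⟩ := (List.mem_ofFn' _ _).1 hy
      exact h _ (Fin.succ_ne_zero i)
    | succ j =>
      rw [h 0 (Fin.succ_ne_zero j).symm, one_mul]
      exact list_ofFn_prod_eq_single (fun i => X i.succ) j fun i hi =>
        h _ fun e => hi (Fin.succ_injective _ e)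

/-- The interval `p` of the partition `P` contains the point `t`. -/
def Contains (P : DyadicPartition) (p : Piece P) (t : ℝ) : Prop :=
  t ∈ Set.Ico (left P p) (left P p + len P p)

/-- Half-open intervals of a partition are disjoint, so exactly one summand survives, also when the
point is an end point. -/
theorem fieldOp_eq {d : ℕ} (A : Matrix (Fin d) (Fin d) ℂ) (c : ℂ) {P : DyadicPartition}
    {p : Piece P} {z : UnitAddCircle} (hp : Contains P p (rep z)) :
    fieldOp A c P z = c ^ (-(level P p : ℤ)) • onPiece P p A := by
  classical
  rw [fieldOp, Finset.sum_eq_single p]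
  · exact if_pos hp
  · intro q _ hq
    exact if_neg fun h => hq (piece_unique P _ q p h.1 h.2 hp.1 hp.2)
  · simp

theorem fieldProd_eq {d n : ℕ} {ι : Type*} (μ : ι → Matrix (Fin d) (Fin d) ℂ) (lam : ι → ℂ)
    (α : Fin n → ι) {P : DyadicPartition} {z : Fin n → UnitAddCircle} {p : Fin n → Piece P}
    (hp : ∀ j, Contains P (p j) (rep (z j))) :
    fieldProd μ lam α P z = (∏ j, lam (α j) ^ (-(level P (p j) : ℤ))) •
      (List.ofFn fun j => onPiece P (p j) (μ (α j))).prod := by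
  rw [fieldProd, ← list_ofFn_prod_smul]
  simp only [fieldOp_eq _ _ (hp _)]

theorem prod_onPiece {d n : ℕ} {P : DyadicPartition} (p : Fin n → Piece P)
    (A : Fin n → Matrix (Fin d) (Fin d) ℂ) :
    (List.ofFn fun j => onPiece P (p j) (A j)).prod =
      tensorOp P (List.ofFn fun j => Pi.mulSingle (p j) (A j)).prod := by
  rw [map_list_prod, List.map_ofFn]
  simp only [Function.comp_def, tensorOp_mulSingle]

theorem prod_onPiece_relabel {d n : ℕ} {P Q : DyadicPartition} (σ : Piece P ≃ Piece Q)
    (p : Fin n → Piece P) (A : Fin n → Matrix (Fin d) (Fin d) ℂ) (ψ : State d P) :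
    (List.ofFn fun j => onPiece Q (σ (p j)) (A j)).prod (relabel d σ ψ) =
      relabel d σ ((List.ofFn fun j => onPiece P (p j) (A j)).prod ψ) := by
  induction n with
  | zero => simp
  | succ n ih =>
    rw [List.ofFn_succ, List.ofFn_succ, List.prod_cons, List.prod_cons, Module.End.mul_apply,
      Module.End.mul_apply, ih (fun j => p j.succ), onPiece_relabel]

/-- Injectivity of `p` puts at most one operator below each interval of `P`, so every subtree sees
either a single eigenmatrix or only identities. Two operators in one subtree would meet at a vertex,
where the eigenvalue equation says nothing. -/
theorem inner_fineGrain_prod_onPiece {d n : ℕ} (V : Vertex d)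
    (hswap : ∀ (φ : EuclideanSpace ℂ (Fin d)) (a b : Fin d), V φ (a, b) = V φ (b, a))
    {A : Fin n → Matrix (Fin d) (Fin d) ℂ} {c : Fin n → ℂ} (hA : ∀ j, ascend V (A j) = c j • A j)
    (P : DyadicPartition) (h : Piece P → DyadicPartition) {p : Fin n → Piece P}
    (hp : Function.Injective p) (r : ∀ j, Piece (h (p j))) (ψ φ : State d P) :
    inner ℂ (fineGrain V P (graft P h) (le_graft P h) ψ)
      ((List.ofFn fun j => onPiece (graft P h) (graftEquiv P h ⟨p j, r j⟩) (A j)).prod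
        (fineGrain V P (graft P h) (le_graft P h) φ)) =
    (∏ j, c j ^ level (h (p j)) (r j)) *
      inner ℂ ψ ((List.ofFn fun j => onPiece P (p j) (A j)).prod φ) := by
  rw [prod_onPiece, inner_fineGrain_tensorOp, ← inner_smul_right, ← LinearMap.smul_apply,
    ← list_ofFn_prod_smul]
  -- Absorbing the scalars into the matrices makes both sides product operators, which can then be
  -- compared one interval at a time.
  have hs : ∀ j, c j ^ level (h (p j)) (r j) • onPiece P (p j) (A j) =
      onPiece P (p j) (c j ^ level (h (p j)) (r j) • A j) := fun j => by
    refine LinearMap.ext fun ψ => ?_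
    ext k
    change c j ^ level (h (p j)) (r j) * ∑ a, A j (k (p j)) a * ψ (Function.update k (p j) a) =
      ∑ a, (c j ^ level (h (p j)) (r j) • A j) (k (p j)) a * ψ (Function.update k (p j) a)
    simp [Finset.mul_sum, mul_assoc]
  simp only [hs]
  rw [prod_onPiece]
  congr 3
  ext1 q
  simp only [list_ofFn_prod_apply]
  -- If `q` holds a field, its subtree yields the power of the eigenvalue; otherwise it holds only
  -- identities and collapses to `1`.
  by_cases hq : ∃ j, p j = q
  · obtain ⟨j, rfl⟩ := hq
    rw [list_ofFn_prod_eq_single _ j fun i hi =>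
      Pi.mulSingle_eq_of_ne (fun e => hi (hp e.symm)) _, Pi.mulSingle_eq_same,
      ← ascendTree_mulSingle V hswap (hA j)]
    congr 1
    ext1 s
    rw [list_ofFn_prod_eq_single _ j]
    · exact congrFun (mulSingle_comp_of_injective
        ((graftEquiv P h).injective.comp sigma_mk_injective) (r j) (A j)) s
    · intro i hi
      refine Pi.mulSingle_eq_of_ne (fun e => hi (hp ?_)) _
      exact (congrArg Sigma.fst ((graftEquiv P h).injective e)).symm
  · push Not at hq
    rw [List.prod_eq_one (l := List.ofFn _), ← ascendTree_one V (h q)]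
    · congr 1
      ext1 s
      rw [List.prod_eq_one]
      intro y hy
      obtain ⟨j, rfl⟩ := (List.mem_ofFn' _ _).1 hy
      refine Pi.mulSingle_eq_of_ne (fun e => hq j ?_) _
      exact (congrArg Sigma.fst ((graftEquiv P h).injective e)).symm
    · intro y hy
      obtain ⟨j, rfl⟩ := (List.mem_ofFn' _ _).1 hy
      exact Pi.mulSingle_eq_of_ne (hq j).symm _

/-! ### Stability under refinement and existence of the limits -/

theorem rep_coe {t : ℝ} (h0 : 0 ≤ t) (h1 : t < 1) : rep (t : UnitAddCircle) = t := by
  have h := (AddCircle.equivIco (1 : ℝ) 0 (t : UnitAddCircle)).2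
  exact circle_coe_inj h.1 (h.2.trans_eq (zero_add 1)) h0 h1 AddCircle.coe_equivIco

/-- The embedding `incl V P` is injective, so the chosen representative is the given one. -/
theorem expectation_eq {d n : ℕ} (V : Vertex d) {ι : Type*}
    (μ : ι → Matrix (Fin d) (Fin d) ℂ) (lam : ι → ℂ) (α : Fin n → ι)
    (z : Fin n → UnitAddCircle) (P : DyadicPartition) (φ : State d P) :
    expectation V μ lam α (incl V P φ) z P = inner ℂ φ (fieldProd μ lam α P z φ) := by
  have h : ∃ φ' : State d P, incl V P φ' = incl V P φ := ⟨φ, rfl⟩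
  rw [expectation, dif_pos h, (incl V P).injective h.choose_spec]

theorem incl_fineGrain {d : ℕ} (V : Vertex d) {P Q : DyadicPartition} (h : P ≤ Q)
    (ψ : State d P) : incl V Q (fineGrain V P Q h ψ) = incl V P ψ := by
  change ((preIncl V Q (fineGrain V P Q h ψ) : PreLimit V) : Limit V) = (preIncl V P ψ : Limit V)
  rw [preIncl_fineGrain]

/-- The inner products that define the expectation values do not change under refinement of a
partition that separates the points. -/
theorem inner_fieldProd_fineGrain {d n : ℕ} (V : Vertex d)
    (hswap : ∀ (φ : EuclideanSpace ℂ (Fin d)) (a b : Fin d), V φ (a, b) = V φ (b, a))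
    {ι : Type*} {μ : ι → Matrix (Fin d) (Fin d) ℂ} {lam : ι → ℂ}
    (hE : ∀ a, ascend V (μ a) = lam a • μ a) {α : Fin n → ι} (hlam : ∀ j, lam (α j) ≠ 0)
    {z : Fin n → UnitAddCircle} {P Q : DyadicPartition} {p : Fin n → Piece P}
    (hp : Function.Injective p) (hz : ∀ j, Contains P (p j) (rep (z j))) (hPQ : P ≤ Q)
    (ψ φ : State d P) :
    inner ℂ (fineGrain V P Q hPQ ψ) (fieldProd μ lam α Q z (fineGrain V P Q hPQ φ)) =
      inner ℂ ψ (fieldProd μ lam α P z φ) := by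
  obtain ⟨h, rfl⟩ := exists_graft hPQ
  have hr : ∀ j, ∃ r, Contains (graft P h) (graftEquiv P h ⟨p j, r⟩) (rep (z j)) := fun j => by
    have hl := len_pos P (p j)
    have h1 := (hz j).1
    have h2 := (hz j).2
    -- The subinterval containing the point is found by rescaling its interval of `P` to the unit
    -- interval and locating the point in the partition grafted there.
    obtain ⟨r, hr1, hr2⟩ := exists_piece (h (p j)) ((rep (z j) - left P (p j)) / len P (p j))
      (div_nonneg (by linarith) hl.le) (by rw [div_lt_one hl]; linarith)
    rw [le_div_iff₀ hl] at hr1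
    rw [div_lt_iff₀ hl] at hr2
    refine ⟨r, ?_⟩
    rw [Contains, left_graft, len_graft]
    exact ⟨by linarith, by linarith⟩
  choose r hr using hr
  rw [fieldProd_eq μ lam α hr, fieldProd_eq μ lam α hz, LinearMap.smul_apply,
    LinearMap.smul_apply, inner_smul_right, inner_smul_right,
    inner_fineGrain_prod_onPiece V hswap (fun j => hE (α j)) P h hp r, ← mul_assoc,
    ← Finset.prod_mul_distrib]
  congr 1
  refine Finset.prod_congr rfl fun j _ => ?_
  -- Levels add under grafting: the finer weight has the extra factor `λ ^ (-level r)`, which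
  -- cancels the `λ ^ level r` from coarse-graining because `λ ≠ 0`.
  rw [level_graft, ← zpow_natCast, ← zpow_add₀ (hlam j)]
  congr 1
  push_cast
  ring

/-- On all refinements of a separating partition the expectation value is constant, so the limit can
be read off on `P` itself. -/
theorem hasNPoint_and_eq {d n : ℕ} (V : Vertex d)
    (hswap : ∀ (φ : EuclideanSpace ℂ (Fin d)) (a b : Fin d), V φ (a, b) = V φ (b, a))
    {ι : Type*} {μ : ι → Matrix (Fin d) (Fin d) ℂ} {lam : ι → ℂ}
    (hE : ∀ a, ascend V (μ a) = lam a • μ a) {α : Fin n → ι} (hlam : ∀ j, lam (α j) ≠ 0)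
    {z : Fin n → UnitAddCircle} {P : DyadicPartition} {p : Fin n → Piece P}
    (hp : Function.Injective p) (hz : ∀ j, Contains P (p j) (rep (z j))) (φ : State d P) :
    HasNPoint V μ lam α (incl V P φ) z ∧
      nPoint V μ lam α (incl V P φ) z = inner ℂ φ (fieldProd μ lam α P z φ) := by
  have ht : Tendsto (expectation V μ lam α (incl V P φ) z) atTop
      (𝓝 (inner ℂ φ (fieldProd μ lam α P z φ))) := by
    refine tendsto_const_nhds.congr' ?_
    filter_upwards [eventually_ge_atTop P] with Q hQ
    rw [← incl_fineGrain V hQ, expectation_eq,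
      inner_fieldProd_fineGrain V hswap hE hlam hp hz hQ]
  have he : nPoint V μ lam α (incl V P φ) z = inner ℂ φ (fieldProd μ lam α P z φ) :=
    ht.limUnder_eq
  refine ⟨⟨?_, by rwa [he]⟩, he⟩
  filter_upwards [eventually_ge_atTop P] with Q hQ
  exact ⟨fineGrain V P Q hQ φ, incl_fineGrain V hQ φ⟩

/-! ### Separating the points -/

theorem len_le_of_regular_le {N : ℕ} {P : DyadicPartition} (h : regular N ≤ P) (p : Piece P) :
    len P p ≤ 2⁻¹ ^ N := by
  obtain ⟨g, rfl⟩ := exists_graft h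
  obtain ⟨⟨q, r⟩, rfl⟩ := (graftEquiv (regular N) g).surjective p
  have h1 := left_nonneg (g q) r
  have h2 := left_add_len_le (g q) r
  rw [len_graft, len, level_regular]
  exact mul_le_of_le_one_right (by positivity) (by linarith)

/-- Distinct points lie in distinct intervals of all sufficiently fine partitions. -/
theorem exists_regular_separates {n : ℕ} {x : Fin n → ℝ} (hinj : Function.Injective x) :
    ∃ N, ∀ P, regular N ≤ P → ∀ p : Fin n → Piece P, (∀ j, Contains P (p j) (x j)) →
      Function.Injective p := by
  -- There are finitely many pairs, so one mesh size lies below all distances between distinct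
  -- points.
  have h : ∀ᶠ N : ℕ in atTop, ∀ i j, i ≠ j → (2⁻¹ : ℝ) ^ N < |x i - x j| := by
    refine eventually_all.2 fun i => eventually_all.2 fun j => ?_
    by_cases hij : i = j
    · simp [hij]
    have hpos : 0 < |x i - x j| := abs_pos.2 (sub_ne_zero.2 fun e => hij (hinj e))
    filter_upwards [(tendsto_pow_atTop_nhds_zero_of_lt_one (r := (2⁻¹ : ℝ)) (by norm_num)
      (by norm_num)).eventually_lt_const hpos] with N hN _ using hN
  obtain ⟨N, hN⟩ := h.exists
  refine ⟨N, fun P hP p hp i j hij => ?_⟩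
  by_contra hne
  have h1 := hN i j hne
  have h2 := len_le_of_regular_le hP (p j)
  have h3 := hp i
  have h4 := hp j
  rw [hij] at h3
  -- Two points of the same half-open interval are closer than its length, which is at most `2⁻¹ ^
  -- N`.
  have : |x i - x j| < len P (p j) := abs_lt.2 ⟨by linarith [h3.1, h4.2], by linarith [h3.2, h4.1]⟩
  linarith

/-! ### Values and right derivatives on a carried interval -/

/-- The image interval lies in `[0,1)`, so its affine parametrization already gives the
representative and no wrap-around occurs. -/
theorem Carries.circleFun_eq {f : UnitAddCircle ≃ₜ UnitAddCircle} {P Q : DyadicPartition}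
    {p : Piece P} {q : Piece Q} (h : Carries f p q) {t : ℝ} (ht : Contains P p t) :
    circleFun f t = left Q q + len Q q * ((t - left P p) / len P p) ∧
      Contains Q q (circleFun f t) := by
  have hl := len_pos P p
  have hq := len_pos Q q
  have u0 : 0 ≤ (t - left P p) / len P p := div_nonneg (by linarith [ht.1]) hl.le
  have u1 : (t - left P p) / len P p < 1 := by rw [div_lt_one hl]; linarith [ht.2]
  have hc := h _ u0 u1
  have hb := piece_point_bounds q u0 u1
  rw [mul_div_cancel₀ _ hl.ne', add_sub_cancel] at hc
  have he : circleFun f t = left Q q + len Q q * ((t - left P p) / len P p) := by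
    rw [circleFun, hc, rep_coe hb.1 hb.2]
  refine ⟨he, ?_⟩
  rw [he]
  refine ⟨?_, ?_⟩
  · have := mul_nonneg hq.le u0
    linarith
  · have := mul_lt_mul_of_pos_left u1 hq
    linarith

/-- A half-open interval contains a right neighbourhood of each of its points, so breakpoints need
no separate treatment. The slope is the ratio of the two lengths. -/
theorem Carries.hasDerivWithinAt {f : UnitAddCircle ≃ₜ UnitAddCircle} {P Q : DyadicPartition}
    {p : Piece P} {q : Piece Q} (h : Carries f p q) {t : ℝ} (ht : Contains P p t) :
    HasDerivWithinAt (circleFun f) (2 ^ ((level P p : ℤ) - level Q q)) (Set.Ici t) t := by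
  have hd : HasDerivAt (fun s => left Q q + len Q q * ((s - left P p) / len P p))
      (len Q q * (1 / len P p)) t :=
    ((((hasDerivAt_id t).sub_const _).div_const _).const_mul _).const_add _
  have hs : len Q q * (1 / len P p) = 2 ^ ((level P p : ℤ) - level Q q) := by
    rw [len, len, zpow_sub₀ two_ne_zero, zpow_natCast, zpow_natCast, inv_pow, inv_pow]
    field_simp
  rw [← hs]
  refine hd.hasDerivWithinAt.congr_of_eventuallyEq ?_ (h.circleFun_eq ht).1
  filter_upwards [self_mem_nhdsWithin, mem_nhdsWithin_of_mem_nhds (Iio_mem_nhds ht.2)] with s h1 h2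
  exact (h.circleFun_eq ⟨ht.1.trans h1, h2⟩).1

theorem Carries.rightDeriv_eq {f : UnitAddCircle ≃ₜ UnitAddCircle} {P Q : DyadicPartition}
    {p : Piece P} {q : Piece Q} (h : Carries f p q) {t : ℝ} (ht : Contains P p t) :
    rightDeriv f t = 2 ^ ((level P p : ℤ) - level Q q) :=
  (h.hasDerivWithinAt ht).derivWithin (uniqueDiffWithinAt_Ici t)

/-! ### Powers of the eigenvalues -/

/-- The logarithm of the slope is an integer, so the complex power is an ordinary one and involves
no choice of branch. -/
theorem cpow_neg_logb_two_zpow (c : ℂ) (k : ℤ) :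
    c ^ (-(Real.logb 2 ((2 : ℝ) ^ k) : ℂ)) = c ^ (-k) := by
  rw [← Real.rpow_intCast, Real.logb_rpow two_pos (by norm_num), ← Complex.cpow_intCast]
  push_cast
  rfl

/-- Since `Re log c = log ‖c‖`, both sides equal `exp (-k log ‖c‖)`; the phase of `c` does not
contribute. -/
theorem two_zpow_rpow_scalingDim {c : ℂ} (hc : c ≠ 0) (k : ℤ) :
    ((2 : ℝ) ^ k) ^ scalingDim c = ‖c‖ ^ (-k) := by
  have h2 : Real.log 2 ≠ 0 := (Real.log_pos one_lt_two).ne'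
  have hs : scalingDim c = -(Real.log ‖c‖ / Real.log 2) := by
    rw [scalingDim, Complex.div_ofReal_re, Complex.log_re]
  rw [hs, Real.rpow_def_of_pos (by positivity), Real.log_zpow, ← Real.rpow_intCast,
    Real.rpow_def_of_pos (norm_pos_iff.2 hc)]
  congr 1
  push_cast
  field_simp

end ThompsonField

/-! ### Covariance of the correlation functions -/

theorem mainTheorem4 {d : ℕ} (V : Vertex d)
    (hswap : ∀ (φ : EuclideanSpace ℂ (Fin d)) (a b : Fin d), V φ (a, b) = V φ (b, a))
    {ι : Type*} (μ : ι → Matrix (Fin d) (Fin d) ℂ) (lam : ι → ℂ)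
    (hE : ∀ a, ascend V (μ a) = lam a • μ a)
    (f : thompsonT) {n : ℕ} (α : Fin n → ι) (hlam : ∀ j, lam (α j) ≠ 0)
    (x : Fin n → ℝ) (hx : ∀ j, x j ∈ Set.Ico (0 : ℝ) 1) (hinj : Function.Injective x) :
    (∀ j, HasDerivWithinAt (circleFun f.1) (rightDeriv f.1 (x j)) (Set.Ici (x j)) (x j) ∧
      ∃ k : ℤ, rightDeriv f.1 (x j) = 2 ^ k) ∧
    HasNPoint V μ lam α (vacuum V) (fun j => (x j : UnitAddCircle)) ∧
    HasNPoint V μ lam α (unitaryRep V f (vacuum V)) (fun j => f.1 (x j : UnitAddCircle)) ∧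
    nPoint V μ lam α (vacuum V) (fun j => (x j : UnitAddCircle)) =
      (∏ j, lam (α j) ^ (-(Real.logb 2 (rightDeriv f.1 (x j)) : ℂ))) *
        nPoint V μ lam α (unitaryRep V f (vacuum V)) (fun j => f.1 (x j : UnitAddCircle)) ∧
    ‖nPoint V μ lam α (vacuum V) (fun j => (x j : UnitAddCircle))‖ =
      (∏ j, rightDeriv f.1 (x j) ^ scalingDim (lam (α j))) *
        ‖nPoint V μ lam α (unitaryRep V f (vacuum V)) (fun j => f.1 (x j : UnitAddCircle))‖ ∧
    ((∀ j, 0 < (lam (α j)).re ∧ (lam (α j)).im = 0) →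
      nPoint V μ lam α (vacuum V) (fun j => (x j : UnitAddCircle)) =
        ((∏ j, rightDeriv f.1 (x j) ^ scalingDim (lam (α j)) : ℝ) : ℂ) *
          nPoint V μ lam α (unitaryRep V f (vacuum V))
            (fun j => f.1 (x j : UnitAddCircle))) := by
  -- The partition `P` must meet three demands at once: separate the points, carry a representative
  -- of the vacuum, and be good for `f`. The first two survive refinement, so goodness is arranged
  -- last.
  obtain ⟨N, hN⟩ := exists_regular_separates hinj
  obtain ⟨R, hR, hvac⟩ := exists_common_refinement (regular N) (.split (.split .whole .whole) .whole)
  obtain ⟨P, Q, σ, hg, hP⟩ := exists_isGood_ge f R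
  choose p hp using fun j => exists_piece P (x j) (hx j).1 (hx j).2
  have hpx : ∀ j, Contains P (p j) (x j) := hp
  have hpinj := hN P (hR.trans hP) p hpx
  have hz : ∀ j, Contains P (p j) (rep (x j : UnitAddCircle)) := fun j => by
    rw [rep_coe (hx j).1 (hx j).2]
    exact hpx j
  have hfz : ∀ j, Contains Q (σ (p j)) (rep (f.1 (x j : UnitAddCircle))) := fun j =>
    ((hg (p j)).circleFun_eq (hpx j)).2
  have hder : ∀ j, rightDeriv f.1 (x j) = 2 ^ ((level P (p j) : ℤ) - level Q (σ (p j))) :=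
    fun j => (hg (p j)).rightDeriv_eq (hpx j)
  set φ : State d P := fineGrain V _ P (hvac.trans hP) (vacuumState V)
  have hv : vacuum V = incl V P φ := (incl_fineGrain V _ _).symm
  have hfv : unitaryRep V f (vacuum V) = incl V Q (relabel d σ φ) := by
    rw [hv, unitaryRep_incl V f hg]
  obtain ⟨hA, hA'⟩ := hasNPoint_and_eq V hswap hE hlam hpinj hz φ
  -- The image partition separates the image points because `σ` is injective, so both correlation
  -- functions are evaluated without any further refinement.
  obtain ⟨hB, hB'⟩ := hasNPoint_and_eq V hswap hE hlam (σ.injective.comp hpinj) hfz (relabel d σ φ)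
  rw [← hv] at hA hA'
  rw [← hfv] at hB hB'
  have hmain : nPoint V μ lam α (vacuum V) (fun j => (x j : UnitAddCircle)) =
      (∏ j, lam (α j) ^ (-((level P (p j) : ℤ) - level Q (σ (p j))))) *
        nPoint V μ lam α (unitaryRep V f (vacuum V)) (fun j => f.1 (x j : UnitAddCircle)) := by
    -- Relabelling intertwines the inserted operators and preserves inner products, so only the
    -- scalar weights remain to be compared.
    rw [hA', hB', fieldProd_eq μ lam α hz, fieldProd_eq μ lam α hfz, LinearMap.smul_apply,
      LinearMap.smul_apply, inner_smul_right, inner_smul_right, prod_onPiece_relabel,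
      LinearIsometryEquiv.inner_map_map, ← mul_assoc, ← Finset.prod_mul_distrib]
    congr 1
    refine Finset.prod_congr rfl fun j _ => ?_
    -- In terms of levels `a` on `P` and `b` on `Q`, the exponents satisfy `-a = -(a - b) + -b`.
    rw [← zpow_add₀ (hlam j)]
    congr 1
    ring
  refine ⟨fun j => ⟨?_, _, hder j⟩, hA, hB, ?_, ?_, fun hpos => ?_⟩
  · rw [hder j]
    exact (hg (p j)).hasDerivWithinAt (hpx j)
  · rw [hmain]
    simp only [hder, cpow_neg_logb_two_zpow]
  · rw [hmain, norm_mul, norm_prod]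
    simp only [hder, two_zpow_rpow_scalingDim (hlam _), norm_zpow]
  · rw [hmain]
    simp only [hder, two_zpow_rpow_scalingDim (hlam _)]
    push_cast
    congr 1
    refine Finset.prod_congr rfl fun j _ => ?_
    -- A positive real eigenvalue equals its own norm, so the modulus in the scaling factor can be
    -- dropped.
    have hre : lam (α j) = ((lam (α j)).re : ℂ) := Complex.ext rfl (by simp [(hpos j).2])
    congr 1
    rw [hre, Complex.norm_real, Real.norm_of_nonneg (hpos j).1.le]
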